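/- **Market.** There are finitely many buyer types $i\in B$ ($B\neq\emptyset$) and finitely many items $t\in S$. Type $i$ has a non-empty demand set $S_i\subseteq S$, a finite population $T_i>0$ and an inverse demand function $\lambda_i:[0,T_i)\to(0,\infty)$ that is non-increasing, continuous, and continuously differentiable on $(0,T_i)$. Item $t$ has a convex, continuously differentiable production cost $C_t:[0,\infty)\to\mathbb R$ with $C_t(0)=0$ and marginal cost $c_t=C_t'$. Assume that every $\lambda_i$ has a *monotone hazard rate* ($\lambda_i'/\lambda_i$ is non-increasing on $(0,T_i)$) and that the costs are *doubly convex* (every $c_t$ is convex and $c_t(0)=0$). Put $\lambda^{\min}=\min_i\lambda_i(0)$, $\lambda^{\max}=\max_i\lambda_i(0)$, $\Delta=\lambda^{\max}/\lambda^{\min}$. **Solutions.** A feasible allocation is $y=(y_t(i))\ge 0$ with $y_t(i)=0$ for $t\notin S_i$ and demand $x_i=\sum_t y_t(i)\le T_i$; write $y_t=\sum_i y_t(i)$, $C(y)=\sum_tC_t(y_t)$. Given prices $p$, let $\bar p_i=\min_{t\in S_i}p_t$. The demand $x_i\in[0,T_i]$ is a best response to $\bar p_i$ if $\lambda_i\ge\bar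 p_i$ on $[0,x_i)$ and $\lambda_i\le\bar p_i$ on $(x_i,T_i)$. The pair $(p,y)$ is *envy-free* if $y$ is feasible, every $x_i$ is a best response to $\bar p_i$, and $y_t(i)>0$ implies $p_t=\bar p_i$. Its revenue is $\sum_t(p_ty_t-C_t(y_t))$; the welfare of $y$ is $SW(y)=\sum_i\int_0^{x_i}\lambda_i(x)\,dx-C(y)$. **Ascending-price procedure.** Take a feasible allocation $y^*$ of maximum welfare and start with prices $p_t=c_t(y^*_t)$ and allocation $y^*$. The cheapest items and the buyer types using them (receiving a positive amount) are *active*, everything else is *inactive*, and the common price of the active items is the active price. The active price is increased continuously; at each active price the active buyer types have best-response demand and are served by active items through a flow of minimum total cost on the active subgraph, all other allocations staying fixed. When the active price reaches the price of an inactive item, that item and the inactive buyer types using it become active. When an active item satisfies $p_t-c_t(y_t)\ge\frac1e(\lambda^{\min}-c_t(y_t))$ in the current solution, that item and the active buyer types using it become *finished*, their prices and allocations being frozen. The active price is not raised past a price at which one of these two events is pending. The procedure ends when all items are finished. **Bicriteria algorithm.** Let $(p(0),y(0))$ be a solution returned by the procedure. For $1\le j\le\lceil\log\Delta\rceil$ let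 $p_t(j)=\max(p_t(0),e^{j-1}\lambda^{\min})$, let $x(j)$ be a best-response demand to $p(j)$ (if it is not unique, any one with $x(j)\le x(0)$), and let $y(j)$ have minimum total cost among the allocations with demand $x(j)$ that are envy-free at prices $p(j)$. Return $(p(j),y(j))$ for the smallest $j\in\{0,\dots,\lceil\log\Delta\rceil\}$ whose revenue is at least $\frac12\cdot\frac{SW(y(0))}{4.5\,(1+\log\Delta)}$. **Theorem.** There is a universal constant $K>0$ such that for every market as above the bicriteria algorithm has a run that returns a solution, and every solution $(p,y)$ that it returns (whatever choices are made among non-unique optima, flows and demands) 1. is envy-free; 2. is a $K(1+\log\Delta)$-approximation to the optimal revenue: every envy-free solution has revenue at most $K(1+\log\Delta)$ times the revenue of $(p,y)$; 3. has at least $\frac14$ of the optimal welfare: $SW(y)\ge\frac14\,SW(z)$ for every feasible allocation $z$. -/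

import Mathlib

open Set

noncomputable section

namespace EnvyFreePricing

/-- A large market with finitely many buyer types `B` and items `S`.
`items i` is the demand set of type `i`, `pop i` its (finite, positive) population,
`lam i` its inverse demand function on `[0, pop i)`, and `cost t` the production cost of item `t`
on `[0, ∞)`.  -/
structure Market (B S : Type*) where
  items : B → Finset S
  items_nonempty : ∀ i, (items i).Nonempty
  pop : B → ℝ
  pop_pos : ∀ i, 0 < pop i
  lam : B → ℝ → ℝ
  lam_pos : ∀ i, ∀ x ∈ Ico 0 (pop i), 0 < lam i x
  lam_antitone : ∀ i, AntitoneOn (lam i) (Ico 0 (pop i))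
  lam_continuous : ∀ i, ContinuousOn (lam i) (Ico 0 (pop i))
  lam_contDiff : ∀ i, ContDiffOn ℝ 1 (lam i) (Ioo 0 (pop i))
  cost : S → ℝ → ℝ
  cost_zero : ∀ t, cost t 0 = 0
  cost_convex : ∀ t, ConvexOn ℝ (Ici 0) (cost t)
  cost_contDiff : ∀ t, ContDiffOn ℝ 1 (cost t) (Ici 0)

/-- A solution: item prices and the amount `alloc i t` of item `t` given to buyer type `i`.
The demand vector is the vector of row sums of `alloc`. -/
structure Solution (B S : Type*) where
  price : S → ℝ
  alloc : B → S → ℝ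

/-- Status of an item or a buyer type during the ascending-price procedure. -/
inductive Status where
  | inactive
  | active
  | finished

/-- State of the ascending-price procedure; `clock` is the active price. -/
structure AscState (B S : Type*) where
  clock : ℝ
  price : S → ℝ
  alloc : B → S → ℝ
  itemStatus : S → Status
  buyerStatus : B → Status

/-- The total amount received by buyer type `i`. -/
def demand {B S : Type*} [Fintype S] (y : B → S → ℝ) (i : B) : ℝ := ∑ t, y i t

/-- The total amount of item `t` that is allocated. -/
def supply {B S : Type*} [Fintype B] (y : B → S → ℝ) (t : S) : ℝ := ∑ i, y i t

namespace Market

variable {B S : Type*} [Fintype B] [Fintype S] (M : Market B S)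

/-- The marginal cost of item `t`: the derivative of its cost function
(one-sided at zero). -/
def mcost (t : S) (y : ℝ) : ℝ := derivWithin (M.cost t) (Ici 0) y

/-- Monotone hazard rate of every inverse demand function. -/
def IsMHR : Prop :=
  ∀ i, AntitoneOn (fun x => deriv (M.lam i) x / M.lam i x) (Ioo 0 (M.pop i))

/-- Doubly convex costs: on top of the convexity of the costs, every marginal cost is convex and
vanishes at zero. -/
def IsDoublyConvex : Prop :=
  ∀ t, ConvexOn ℝ (Ici 0) (M.mcost t) ∧ M.mcost t 0 = 0

/-- The smallest peak. -/
def minPeak : ℝ := ⨅ i, M.lam i 0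

/-- The largest peak. -/
def maxPeak : ℝ := ⨆ i, M.lam i 0

/-- The ratio of the largest peak to the smallest peak. -/
def peakRatio : ℝ := M.maxPeak / M.minPeak

/-! ### Allocations, envy-freeness, revenue and welfare -/

/-- Feasible allocations: non-negative, along the edges of the bipartite graph only, and within the
population of every type. -/
def IsFeasible (y : B → S → ℝ) : Prop :=
  (∀ i t, 0 ≤ y i t) ∧ (∀ i t, t ∉ M.items i → y i t = 0) ∧ ∀ i, demand y i ≤ M.pop i

/-- Total production cost. -/
def totalCost (y : B → S → ℝ) : ℝ := ∑ t, M.cost t (supply y t)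

/-- The smallest price available to buyer type `i`. -/
def minPrice (p : S → ℝ) (i : B) : ℝ := (M.items i).inf' (M.items_nonempty i) p

/-- `x` is a best-response demand of type `i` at price `p`: all buyers whose value exceeds `p` buy
and all buyers whose value is below `p` do not.  For `0 < x < pop i` this says `lam i x = p`; it
also covers prices above the peak (`x = 0`) and prices below all values (`x = pop i`). -/
def IsBestResponse (i : B) (p x : ℝ) : Prop :=
  0 ≤ x ∧ x ≤ M.pop i ∧ (∀ z ∈ Ico 0 x, p ≤ M.lam i z) ∧ ∀ z ∈ Ioo x (M.pop i), M.lam i z ≤ p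

/-- Envy-free solutions. -/
def IsEnvyFree (s : Solution B S) : Prop :=
  M.IsFeasible s.alloc ∧
  (∀ i, M.IsBestResponse i (M.minPrice s.price i) (demand s.alloc i)) ∧
  ∀ i t, 0 < s.alloc i t → s.price t = M.minPrice s.price i

/-- Revenue: payments minus production cost. -/
def revenue (s : Solution B S) : ℝ :=
  ∑ t, (s.price t * supply s.alloc t - M.cost t (supply s.alloc t))

/-- Social welfare of an allocation. -/
def welfare (y : B → S → ℝ) : ℝ :=
  ∑ i, (∫ x in (0 : ℝ)..demand y i, M.lam i x) - M.totalCost y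

/-- `y` is feasible and maximizes social welfare. -/
def IsWelfareOptimal (y : B → S → ℝ) : Prop :=
  M.IsFeasible y ∧ ∀ z, M.IsFeasible z → M.welfare z ≤ M.welfare y

/-! ### The ascending-price procedure -/

/-- Stopping criterion with parameter `k` and reference peak `l`, for an item of price `p` and
marginal cost `c`. -/
def MeetsCriterion (k l p c : ℝ) : Prop := 1 / k * (l - c) ≤ p - c

/-- `z` is a flow on the sub-graph induced by the active buyers and items of `σ`: inactive and
finished buyers keep their allocation, active buyers only receive active items they have access
to. -/
def IsActiveFlow (σ : AscState B S) (z : B → S → ℝ) : Prop :=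
  (∀ i, σ.buyerStatus i ≠ Status.active → z i = σ.alloc i) ∧
  ∀ i, σ.buyerStatus i = Status.active →
    ∀ t, 0 ≤ z i t ∧ ((t ∉ M.items i ∨ σ.itemStatus t ≠ Status.active) → z i t = 0)

/-- `z` is a min-cost flow on the active sub-graph of `σ` for a best-response demand of the active
buyers at the active price `q`. -/
def IsActiveMinCost (σ : AscState B S) (q : ℝ) (z : B → S → ℝ) : Prop :=
  M.IsActiveFlow σ z ∧
  (∀ i, σ.buyerStatus i = Status.active → M.IsBestResponse i q (demand z i)) ∧
  ∀ z', M.IsActiveFlow σ z' → (∀ i, demand z' i = demand z i) → M.totalCost z ≤ M.totalCost z'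

open Classical in
/-- Initial state for the welfare-maximizing allocation `y`: every item is priced at its marginal
cost; the cheapest items and the buyers using them are active, all others inactive. -/
def ascInit (y : B → S → ℝ) : AscState B S where
  clock := ⨅ t, M.mcost t (supply y t)
  price := fun t => M.mcost t (supply y t)
  alloc := y
  itemStatus := fun t =>
    if M.mcost t (supply y t) = ⨅ t', M.mcost t' (supply y t') then Status.active
    else Status.inactive
  buyerStatus := fun i =>
    if ∃ t, M.mcost t (supply y t) = (⨅ t', M.mcost t' (supply y t')) ∧ 0 < y i t
    then Status.active else Status.inactive

open Classical in
/-- One step of the ascending-price procedure with parameter `k` and reference peak `l`.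
* `raise`: the active price is increased continuously from `σ.clock` to `q`, with a min-cost flow
  `path r` of the active sub-graph at every intermediate price `r`; on the way no active item meets
  the stopping criterion and no inactive item is passed by the active price.
* `activate`: an inactive item whose price equals the active price becomes active, together with
  the inactive buyers using it.
* `finish`: an active item that meets the stopping criterion in the current solution becomes
  finished, together with the active buyers using it. -/
inductive AscStep (k l : ℝ) : AscState B S → AscState B S → Prop
  | raise (σ : AscState B S) (q : ℝ) (path : ℝ → B → S → ℝ)
      (clock_lt : σ.clock < q)
      (inactive_ge : ∀ t, σ.itemStatus t = Status.inactive → q ≤ σ.price t)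
      (path_start : path σ.clock = σ.alloc)
      (path_minCost : ∀ r ∈ Ioc σ.clock q, M.IsActiveMinCost σ r (path r))
      (not_met : ∀ r ∈ Ico σ.clock q, ∀ t, σ.itemStatus t = Status.active →
        ¬ MeetsCriterion k l r (M.mcost t (supply (path r) t))) :
      AscStep k l σ
        { σ with
          clock := q
          price := fun t => if σ.itemStatus t = Status.active then q else σ.price t
          alloc := path q }
  | activate (σ : AscState B S) (t : S)
      (is_inactive : σ.itemStatus t = Status.inactive)
      (price_eq : σ.price t = σ.clock) :
      AscStep k l σ
        { σ with
          itemStatus := Function.update σ.itemStatus t Status.active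
          buyerStatus := fun i =>
            if σ.buyerStatus i = Status.inactive ∧ 0 < σ.alloc i t then Status.active
            else σ.buyerStatus i }
  | finish (σ : AscState B S) (t : S)
      (is_active : σ.itemStatus t = Status.active)
      (met : MeetsCriterion k l (σ.price t) (M.mcost t (supply σ.alloc t))) :
      AscStep k l σ
        { σ with
          itemStatus := Function.update σ.itemStatus t Status.finished
          buyerStatus := fun i =>
            if σ.buyerStatus i = Status.active ∧ 0 < σ.alloc i t then Status.finished
            else σ.buyerStatus i }

/-- `s` is the solution returned by a terminated run of the ascending-price procedure, i.e. a run
from the welfare optimum to a state in which all items are finished. -/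
def AscReturns (k l : ℝ) (s : Solution B S) : Prop :=
  ∃ (y : B → S → ℝ) (σ : AscState B S), M.IsWelfareOptimal y ∧
    Relation.ReflTransGen (M.AscStep k l) (M.ascInit y) σ ∧
    (∀ t, σ.itemStatus t = Status.finished) ∧
    s = ⟨σ.price, σ.alloc⟩

/-! ### The bicriteria algorithm -/

/-- `s` is a `j`-th candidate (`j ≥ 1`) built from `s₀`: prices are raised to at least
`exp (j - 1) * minPeak`, the demand is a best response, and the allocation has the smallest cost
among the envy-free ones for these prices and this demand.  When best responses are not unique, the
demand is one that does not exceed the demand in `s₀`, whose prices are lower. -/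
def IsCandidate (s₀ : Solution B S) (j : ℕ) (s : Solution B S) : Prop :=
  (∀ t, s.price t = max (s₀.price t) (Real.exp ((j : ℝ) - 1) * M.minPeak)) ∧
  M.IsEnvyFree s ∧
  (∀ i, demand s.alloc i ≤ demand s₀.alloc i) ∧
  ∀ z, M.IsEnvyFree ⟨s.price, z⟩ → (∀ i, demand z i = demand s.alloc i) →
    M.totalCost s.alloc ≤ M.totalCost z

/-- `s` is a solution returned by the bicriteria algorithm: run the ascending-price procedure with
parameter `e` and reference peak `minPeak` to get the candidate `0`, form the candidates
`1, …, ⌈log peakRatio⌉`, and return the first candidate whose revenue is at least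
`(1/2) * (welfare of candidate 0) / (4.5 * (1 + log peakRatio))`. -/
def BicriteriaReturns (s : Solution B S) : Prop :=
  ∃ (cand : ℕ → Solution B S) (j : ℕ),
    M.AscReturns (Real.exp 1) M.minPeak (cand 0) ∧
    (∀ n, 1 ≤ n → n ≤ ⌈Real.log M.peakRatio⌉₊ → M.IsCandidate (cand 0) n (cand n)) ∧
    IsLeast {n : ℕ | n ≤ ⌈Real.log M.peakRatio⌉₊ ∧
      1 / 2 * (M.welfare (cand 0).alloc / (4.5 * (1 + Real.log M.peakRatio)))
        ≤ M.revenue (cand n)} j ∧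
    s = cand j

end Market

end EnvyFreePricing

end

set_option linter.unusedSectionVars false

noncomputable section

namespace EnvyFreePricing
namespace Market

variable {B S : Type*} (M : Market B S)

/-! ### Costs -/

/-! Write `l` for the smallest peak, `L` for the logarithm of the peak ratio, and `c` for marginal
costs in the solution that the ascending-price procedure returns.

Ascending prices. An invariant (`AscInv`) shows that the procedure stays envy-free and that each
item stops when the criterion holds with equality, unless its price never left its marginal cost.
Hence at the end every price is `max c (c + (l - c) / e)` (`AscInv.price_eq`). The allocation may
jump along the price path, since min-cost flows are not unique, but marginal costs move
continuously: an exchange argument shows that they fall with demand, and that a supply whose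
marginal cost changes moves by at most the total change in demand
(`IsActiveEquilibrium.mcost_continuous`). Demand itself is continuous in the price below the peak
because a log-concave inverse demand strictly decreases once it is below its peak. Runs terminate
because each rise of the price can be continued up to an event, and every item takes part in at most
two events.

Welfare. The final price is an increasing function of the marginal cost, so buyers also use the
items of least marginal cost. By the tangent inequality for the costs, comparison with any other
allocation splits into single buyer types. For one type, comparing the log-concave inverse demand
with `c + k * exp (1 - z / x)` shows that the surplus lost is at most `1 / (e - 1)` of the surplus
kept (`IsMHR.surplus_loss_le`). So the solution has a fraction `1 - 1 / e` of the optimal welfare.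

Revenue. Double convexity makes costs at most half of the payments, so payments are at most twice
the revenue, for candidate `0` and for all later ones. Each buyer's cheapest price grows by a factor
of at most `e` from one candidate to the next, and `e` times the last one exceeds every peak. The
gross value lost from candidate `m` to `m + 1` is therefore at most `e` times the payments of `m`
minus those of `m + 1`. Telescoping (`IsCandidateSeq.gross_sub_le`), if all revenues were below the
threshold, the welfare of candidate `0` would be too small, so some candidate passes. At the first
one that passes, the same sum bounds the welfare lost by a fraction `2 * e / 9`, and `(1 - 2 * e /
9) * (1 - 1 / e) ≥ 1 / 4`. Since envy-free revenue never exceeds welfare, the threshold gives the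
revenue guarantee. -/

lemma cost_differentiableOn (t : S) : DifferentiableOn ℝ (M.cost t) (Ici 0) :=
  (M.cost_contDiff t).differentiableOn (by norm_num)

lemma cost_continuousOn (t : S) : ContinuousOn (M.cost t) (Ici 0) :=
  (M.cost_contDiff t).continuousOn

lemma mcost_continuousOn (t : S) : ContinuousOn (M.mcost t) (Ici 0) :=
  (M.cost_contDiff t).continuousOn_derivWithin (uniqueDiffOn_Ici 0) (by norm_num)

lemma mcost_monotoneOn (t : S) : MonotoneOn (M.mcost t) (Ici 0) :=
  (M.cost_convex t).monotoneOn_derivWithin (M.cost_differentiableOn t)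

lemma cost_support (t : S) {u v : ℝ} (hu : 0 ≤ u) (hv : 0 ≤ v) :
    M.cost t v + M.mcost t v * (u - v) ≤ M.cost t u := by
  have hd := M.cost_differentiableOn t v hv
  rcases lt_trichotomy u v with h | rfl | h
  · have := (M.cost_convex t).slope_le_derivWithin (mem_Ici.2 hu) (mem_Ici.2 hv) h hd
    rw [slope_def_field, div_le_iff₀ (by linarith)] at this
    simp only [mcost]; linarith
  · simp
  · have := (M.cost_convex t).derivWithin_le_slope (mem_Ici.2 hv) (mem_Ici.2 hu) h hd
    rw [slope_def_field, le_div_iff₀ (by linarith)] at this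
    simp only [mcost]; linarith

section DoublyConvex

variable {M}

lemma IsDoublyConvex.mcost_nonneg (h : M.IsDoublyConvex) (t : S) {u : ℝ} (hu : 0 ≤ u) :
    0 ≤ M.mcost t u :=
  (h t).2 ▸ M.mcost_monotoneOn t (mem_Ici.2 le_rfl) (mem_Ici.2 hu) hu

lemma IsDoublyConvex.cost_mono (h : M.IsDoublyConvex) (t : S) {u v : ℝ} (hu : 0 ≤ u)
    (huv : u ≤ v) : M.cost t u ≤ M.cost t v := by
  have := M.cost_support t (hu.trans huv) hu
  have := mul_nonneg (h.mcost_nonneg t hu) (sub_nonneg.2 huv)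
  linarith

lemma IsDoublyConvex.cost_nonneg (h : M.IsDoublyConvex) (t : S) {u : ℝ} (hu : 0 ≤ u) :
    0 ≤ M.cost t u :=
  (M.cost_zero t) ▸ h.cost_mono t le_rfl hu

/-- A convex marginal cost vanishing at zero lies below its chord on `[0, u]`; integrating the chord
gives a triangle, half of the rectangle. This factor is what later bounds costs by half of the
payments. -/
lemma IsDoublyConvex.two_mul_cost_le (h : M.IsDoublyConvex) (t : S) {u : ℝ} (hu : 0 ≤ u) :
    2 * M.cost t u ≤ M.mcost t u * u := by
  rcases hu.eq_or_lt with rfl | hu0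
  · simp [M.cost_zero]
  have hmono : MonotoneOn (fun s => M.mcost t u / u * (s ^ 2 / 2) - M.cost t s) (Icc 0 u) := by
    refine monotoneOn_of_deriv_nonneg (convex_Icc 0 u) ?_ ?_ ?_
    · exact (by fun_prop : Continuous fun s : ℝ => M.mcost t u / u * (s ^ 2 / 2)).continuousOn.sub
        ((M.cost_continuousOn t).mono Icc_subset_Ici_self)
    · rw [interior_Icc]
      exact (by fun_prop :
          Differentiable ℝ fun s : ℝ => M.mcost t u / u * (s ^ 2 / 2)).differentiableOn.sub
        ((M.cost_differentiableOn t).mono (Ioo_subset_Icc_self.trans Icc_subset_Ici_self))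
    · intro s hs
      rw [interior_Icc] at hs
      have hd : HasDerivAt (M.cost t) (M.mcost t s) s :=
        (M.cost_differentiableOn t s hs.1.le).hasDerivWithinAt.hasDerivAt (Ici_mem_nhds hs.1)
      have h1 : HasDerivAt (fun s : ℝ => M.mcost t u / u * (s ^ 2 / 2)) (M.mcost t u / u * s) s :=
        (((hasDerivAt_pow 2 s).div_const 2).const_mul _).congr_deriv (by push_cast; ring)
      rw [show deriv (fun s => M.mcost t u / u * (s ^ 2 / 2) - M.cost t s) s = _ from
        (h1.sub hd).deriv, sub_nonneg]
      have hc := (h t).1.2 (mem_Ici.2 le_rfl) (mem_Ici.2 hu)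
        (show 0 ≤ 1 - s / u by rw [sub_nonneg, div_le_one hu0]; exact hs.2.le)
        (show 0 ≤ s / u from div_nonneg hs.1.le hu) (by ring)
      simp only [smul_eq_mul, (h t).2, mul_zero, zero_add, div_mul_cancel₀ s hu0.ne'] at hc
      calc M.mcost t s ≤ s / u * M.mcost t u := hc
        _ = _ := by ring
  have := hmono (left_mem_Icc.2 hu) (right_mem_Icc.2 hu) hu
  simp only [M.cost_zero] at this
  have e : M.mcost t u / u * (u ^ 2 / 2) = M.mcost t u * u / 2 := by field_simp
  rw [e] at this
  norm_num at this
  linarith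

end DoublyConvex

/-! ### Inverse demand -/

lemma zero_mem (i : B) : (0 : ℝ) ∈ Ico 0 (M.pop i) := ⟨le_rfl, M.pop_pos i⟩

lemma lam_le_zero (i : B) {x : ℝ} (hx : x ∈ Ico 0 (M.pop i)) : M.lam i x ≤ M.lam i 0 :=
  M.lam_antitone i (M.zero_mem i) hx hx.1

/-- The inverse demand lies between zero and its peak on the half-open interval. Its value at `M.pop
i` is unconstrained, but a single point does not matter to the integral. -/
lemma lam_intervalIntegrable (i : B) {a b : ℝ} (ha : 0 ≤ a) (haT : a ≤ M.pop i) (hb : 0 ≤ b)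
    (hbT : b ≤ M.pop i) : IntervalIntegrable (M.lam i) MeasureTheory.volume a b := by
  have h0 : MeasureTheory.IntegrableOn (M.lam i) (Ico 0 (M.pop i)) := by
    refine MeasureTheory.IntegrableOn.of_bound (C := M.lam i 0) (by simp)
      ((M.lam_continuous i).aestronglyMeasurable measurableSet_Ico) ?_
    refine (MeasureTheory.ae_restrict_iff' measurableSet_Ico).2 (.of_forall fun x hx => ?_)
    rw [Real.norm_of_nonneg (M.lam_pos i x hx).le]
    exact M.lam_le_zero i hx
  have h1 : IntervalIntegrable (M.lam i) MeasureTheory.volume 0 (M.pop i) := by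
    rw [intervalIntegrable_iff_integrableOn_Ico_of_le (M.pop_pos i).le]; exact h0
  refine h1.mono_set (uIcc_subset_uIcc ?_ ?_) <;>
    rw [uIcc_of_le (M.pop_pos i).le] <;> constructor <;> assumption

lemma integral_lam_le (i : B) {a b K : ℝ} (ha : 0 ≤ a) (hab : a ≤ b) (hb : b ≤ M.pop i)
    (h : ∀ z ∈ Ioo a b, M.lam i z ≤ K) : ∫ x in a..b, M.lam i x ≤ K * (b - a) := by
  have := intervalIntegral.integral_mono_on_of_le_Ioo hab
    (M.lam_intervalIntegrable i ha (hab.trans hb) (ha.trans hab) hb)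
    (intervalIntegrable_const (c := K)) h
  simpa [mul_comm] using this

lemma le_integral_lam (i : B) {a b K : ℝ} (ha : 0 ≤ a) (hab : a ≤ b) (hb : b ≤ M.pop i)
    (h : ∀ z ∈ Ioo a b, K ≤ M.lam i z) : K * (b - a) ≤ ∫ x in a..b, M.lam i x := by
  have := intervalIntegral.integral_mono_on_of_le_Ioo hab
    (intervalIntegrable_const (c := K))
    (M.lam_intervalIntegrable i ha (hab.trans hb) (ha.trans hab) hb) h
  simpa [mul_comm] using this

lemma integral_lam_sub (i : B) {a b : ℝ} (ha : 0 ≤ a) (haT : a ≤ M.pop i) (hb : 0 ≤ b)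
    (hbT : b ≤ M.pop i) :
    (∫ x in (0 : ℝ)..b, M.lam i x) - ∫ x in (0 : ℝ)..a, M.lam i x = ∫ x in a..b, M.lam i x :=
  intervalIntegral.integral_interval_sub_left
    (M.lam_intervalIntegrable i le_rfl (M.pop_pos i).le hb hbT)
    (M.lam_intervalIntegrable i le_rfl (M.pop_pos i).le ha haT)

variable {M}

/-- The hazard rate is the derivative of the logarithm of the inverse demand. -/
lemma IsMHR.concaveOn_log (h : M.IsMHR) (i : B) :
    ConcaveOn ℝ (Ico 0 (M.pop i)) (fun x => Real.log (M.lam i x)) := by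
  have hdiff : ∀ x ∈ Ioo 0 (M.pop i), DifferentiableAt ℝ (M.lam i) x := fun x hx =>
    ((M.lam_contDiff i).differentiableOn (by norm_num) x hx).differentiableAt
      (isOpen_Ioo.mem_nhds hx)
  refine AntitoneOn.concaveOn_of_deriv (convex_Ico _ _) ?_ ?_ ?_
  · exact (M.lam_continuous i).log fun x hx => (M.lam_pos i x hx).ne'
  · rw [interior_Ico]
    intro x hx
    exact ((hdiff x hx).log (M.lam_pos i x (Ioo_subset_Ico_self hx)).ne').differentiableWithinAt
  · rw [interior_Ico]
    refine (h i).congr fun x hx => ?_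
    exact (deriv.log (hdiff x hx) (M.lam_pos i x (Ioo_subset_Ico_self hx)).ne').symm

/-- A concave logarithm that is flat on `[a, b]` cannot have decreased before `a`, so flat stretches
occur only at the level of the peak. -/
lemma IsMHR.lam_lt (h : M.IsMHR) (i : B) {a b : ℝ} (ha : 0 ≤ a) (hab : a < b) (hb : b < M.pop i)
    (hlt : M.lam i b < M.lam i 0) : M.lam i b < M.lam i a := by
  have ha' : a ∈ Ico 0 (M.pop i) := ⟨ha, hab.trans hb⟩
  have hb' : b ∈ Ico 0 (M.pop i) := ⟨ha.trans hab.le, hb⟩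
  refine lt_of_le_of_ne (M.lam_antitone i ha' hb' hab.le) fun heq => ?_
  rcases ha.eq_or_lt with rfl | ha0
  · exact hlt.ne heq
  have := (h.concaveOn_log i).slope_anti_adjacent (M.zero_mem i) hb' ha0 hab
  rw [heq, sub_self, zero_div, sub_zero] at this
  have h2 := mul_nonneg this ha0.le
  rw [div_mul_cancel₀ _ ha0.ne', sub_nonneg, Real.log_le_log_iff (M.lam_pos i 0 (M.zero_mem i))
    (M.lam_pos i a ha')] at h2
  linarith

/-! ### Best responses -/

lemma IsBestResponse.lam_le {i : B} {p x : ℝ} (h : M.IsBestResponse i p x) (hx : x < M.pop i) :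
    M.lam i x ≤ p := by
  by_contra! hp
  have hc := M.lam_continuous i x ⟨h.1, hx⟩
  have h1 : ∀ᶠ z in nhdsWithin x (Ioo x (M.pop i)), p < M.lam i z :=
    (hc.mono (Ioo_subset_Ico_self.trans (Ico_subset_Ico_left h.1))).eventually (lt_mem_nhds hp)
  have : (nhdsWithin x (Ioo x (M.pop i))).NeBot := by
    rw [nhdsWithin_Ioo_eq_nhdsGT hx]; infer_instance
  obtain ⟨z, hz, hz2⟩ := (h1.and self_mem_nhdsWithin).exists
  exact (h.2.2.2 z hz2).not_gt hz

lemma IsBestResponse.le_lam {i : B} {p x : ℝ} (h : M.IsBestResponse i p x) (h0 : 0 < x)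
    (hx : x < M.pop i) : p ≤ M.lam i x := by
  by_contra! hp
  have hc := M.lam_continuous i x ⟨h.1, hx⟩
  have h1 : ∀ᶠ z in nhdsWithin x (Ioo 0 x), M.lam i z < p :=
    (hc.mono (Ioo_subset_Ico_self.trans (Ico_subset_Ico_right hx.le))).eventually (gt_mem_nhds hp)
  have : (nhdsWithin x (Ioo 0 x)).NeBot := by
    rw [nhdsWithin_Ioo_eq_nhdsLT h0]; infer_instance
  obtain ⟨z, hz, hz2⟩ := (h1.and self_mem_nhdsWithin).exists
  exact (h.2.2.1 z (Ioo_subset_Ico_self hz2)).not_gt hz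

lemma IsBestResponse.pos {i : B} {p x : ℝ} (h : M.IsBestResponse i p x) (hp : p < M.lam i 0) :
    0 < x := by
  refine h.1.lt_of_ne fun h0 => ?_
  subst h0
  exact (h.lam_le (M.pop_pos i)).not_gt hp

/-- The prices must differ strictly: at equal prices a flat stretch of the inverse demand admits
many best responses. -/
lemma IsBestResponse.anti {i : B} {p q x z : ℝ} (h : M.IsBestResponse i p x)
    (h' : M.IsBestResponse i q z) (hpq : p < q) : z ≤ x := by
  by_contra! hlt
  have hm : (x + z) / 2 ∈ Ioo x z := ⟨by linarith, by linarith⟩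
  have h1 := h.2.2.2 _ ⟨hm.1, hm.2.trans_le h'.2.1⟩
  have h2 := h'.2.2.1 _ ⟨h.1.trans hm.1.le, hm.2⟩
  linarith

/-- Lets a candidate choose a best response that does not exceed the demand of candidate `0`. -/
lemma IsBestResponse.inf {i : B} {p q x z : ℝ} (h : M.IsBestResponse i p x)
    (h' : M.IsBestResponse i q z) (hpq : p ≤ q) : M.IsBestResponse i q (min z x) := by
  rcases le_total z x with hzx | hzx
  · rwa [min_eq_left hzx]
  · rw [min_eq_right hzx]
    exact ⟨h.1, h.2.1, fun w hw => h'.2.2.1 w ⟨hw.1, hw.2.trans_le hzx⟩,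
      fun w hw => (h.2.2.2 w hw).trans hpq⟩

lemma IsBestResponse.zero_of_le {i : B} {p q : ℝ} (h : M.IsBestResponse i p 0) (hpq : p ≤ q) :
    M.IsBestResponse i q 0 :=
  ⟨le_rfl, h.2.1, fun _ hw => absurd (hw.1.trans_lt hw.2) (lt_irrefl _),
    fun w hw => (h.2.2.2 w hw).trans hpq⟩

variable (M) in
lemma exists_isBestResponse (i : B) (p : ℝ) : ∃ x, M.IsBestResponse i p x := by
  set A : Set ℝ := {x | x ∈ Icc 0 (M.pop i) ∧ ∀ z ∈ Ico 0 x, p ≤ M.lam i z}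
  have hne : A.Nonempty := ⟨0, ⟨le_rfl, (M.pop_pos i).le⟩, by simp⟩
  have hbdd : BddAbove A := ⟨M.pop i, fun x hx => hx.1.2⟩
  refine ⟨sSup A, le_csSup hbdd ⟨⟨le_rfl, (M.pop_pos i).le⟩, by simp⟩,
    csSup_le hne fun x hx => hx.1.2, fun z hz => ?_, fun z hz => ?_⟩
  · obtain ⟨a, ha, hza⟩ := exists_lt_of_lt_csSup hne hz.2
    exact ha.2 z ⟨hz.1, hza⟩
  · by_contra! hlt
    have h0 : 0 ≤ sSup A := le_csSup hbdd ⟨⟨le_rfl, (M.pop_pos i).le⟩, by simp⟩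
    have hz0 : 0 ≤ z := h0.trans hz.1.le
    have : z ∈ A := ⟨⟨hz0, hz.2.le⟩, fun w hw =>
      hlt.le.trans (M.lam_antitone i ⟨hw.1, hw.2.trans hz.2⟩ ⟨hz0, hz.2⟩ hw.2.le)⟩
    exact (le_csSup hbdd this).not_gt hz.1

/-- Best-response demand depends continuously on the price, below the peak. -/
lemma IsMHR.bestResponse_continuous (h : M.IsMHR) {i : B} {p x ε : ℝ} (hp : p < M.lam i 0)
    (hx : M.IsBestResponse i p x) (hε : 0 < ε) :
    ∃ δ > 0, ∀ q z, |q - p| < δ → M.IsBestResponse i q z → |z - x| < ε := by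
  have hup : ∃ δ > 0, ∀ q z, |q - p| < δ → M.IsBestResponse i q z → z < x + ε := by
    by_cases hT : x + ε / 2 < M.pop i
    · have hmem : x + ε / 2 ∈ Ico 0 (M.pop i) := ⟨by linarith [hx.1], hT⟩
      have hle : M.lam i (x + ε / 2) ≤ p := hx.2.2.2 _ ⟨by linarith, hT⟩
      -- Strict decrease below the peak separates the value at a nearby point from `p`; the gap
      -- serves as `δ`.
      have hlt : M.lam i (x + ε / 2) < p :=
        (h.lam_lt i hx.1 (by linarith) hT (hle.trans_lt hp)).trans_le (hx.lam_le (by linarith))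
      refine ⟨p - M.lam i (x + ε / 2), by linarith, fun q z hq hz => ?_⟩
      by_contra! hzx
      have := hz.2.2.1 (x + ε / 2) ⟨hmem.1, by linarith⟩
      have := (abs_lt.1 hq).1
      linarith
    · exact ⟨1, one_pos, fun q z _ hz => by linarith [hz.2.1]⟩
  have hlow : ∃ δ > 0, ∀ q z, |q - p| < δ → M.IsBestResponse i q z → x - ε < z := by
    by_cases h0 : 0 ≤ x - ε
    · have hxT := hx.2.1
      have hgt : p < M.lam i (x - ε / 2) := by
        by_contra! hle
        have h2 := hx.2.2.1 (x - ε / 4) ⟨by linarith, by linarith⟩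
        have h3 := M.lam_antitone i (a := x - ε / 2) (b := x - ε / 4)
          ⟨by linarith, by linarith⟩ ⟨by linarith, by linarith⟩ (by linarith)
        have := h.lam_lt i (a := x - ε / 2) (b := x - ε / 4) (by linarith) (by linarith)
          (by linarith) (by linarith)
        linarith
      refine ⟨M.lam i (x - ε / 2) - p, by linarith, fun q z hq hz => ?_⟩
      by_contra! hzx
      have := hz.2.2.2 (x - ε / 2) ⟨by linarith, by linarith⟩
      have := (abs_lt.1 hq).2
      linarith
    · exact ⟨1, one_pos, fun q z _ hz => by linarith [hz.1]⟩
  obtain ⟨δ₁, h1, H1⟩ := hup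
  obtain ⟨δ₂, h2, H2⟩ := hlow
  refine ⟨min δ₁ δ₂, lt_min h1 h2, fun q z hq hz => abs_lt.2 ⟨?_, ?_⟩⟩
  · linarith [H2 q z (hq.trans_le (min_le_right _ _)) hz]
  · linarith [H1 q z (hq.trans_le (min_le_left _ _)) hz]

end Market
end EnvyFreePricing

namespace EnvyFreePricing

/-! ### Log-concave functions compared with shifted exponentials -/

/-- With `g` the function under the logarithm, the derivative is `-(1 / x) * (1 - c / g)`, which
increases because `g` decreases. -/
lemma convexOn_log_add_exp {c k x : ℝ} (hc : 0 ≤ c) (hk : 0 < k) (hx : 0 < x) :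
    ConvexOn ℝ univ (fun z => Real.log (c + k * Real.exp (1 - z / x))) := by
  have hpos : ∀ z, 0 < c + k * Real.exp (1 - z / x) := fun z => by positivity
  have hd : ∀ z, HasDerivAt (fun z => Real.log (c + k * Real.exp (1 - z / x)))
      (-(1 / x) * (1 - c / (c + k * Real.exp (1 - z / x)))) z := by
    intro z
    have h1 : HasDerivAt (fun z => c + k * Real.exp (1 - z / x))
        (k * (Real.exp (1 - z / x) * (-(1 / x)))) z :=
      (((((hasDerivAt_id z).div_const x).const_sub 1).exp).const_mul k).const_add c
    refine (h1.log (hpos z).ne').congr_deriv ?_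
    have := (hpos z).ne'
    field_simp
    ring
  refine Monotone.convexOn_univ_of_deriv (fun z => (hd z).differentiableAt) ?_
  rw [show deriv (fun z => Real.log (c + k * Real.exp (1 - z / x))) = _ from
    funext fun z => (hd z).deriv]
  intro z w hzw
  have hE : Real.exp (1 - w / x) ≤ Real.exp (1 - z / x) :=
    Real.exp_le_exp.2 (sub_le_sub_left (div_le_div_of_nonneg_right hzw hx.le) 1)
  have h1 : c / (c + k * Real.exp (1 - z / x)) ≤ c / (c + k * Real.exp (1 - w / x)) :=
    div_le_div_of_nonneg_left hc (hpos w) (by gcongr)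
  have h2 : 0 < 1 / x := by positivity
  simp only
  nlinarith

lemma integral_exp_one_sub_div {x a b : ℝ} (hx : 0 < x) :
    ∫ z in a..b, Real.exp (1 - z / x) = x * (Real.exp (1 - a / x) - Real.exp (1 - b / x)) := by
  have hd : ∀ z ∈ uIcc a b, HasDerivAt (fun z => -x * Real.exp (1 - z / x))
      (Real.exp (1 - z / x)) z := fun z _ => by
    refine ((((hasDerivAt_id z).div_const x).const_sub 1).exp.const_mul (-x)).congr_deriv ?_
    simp only [id]
    field_simp
  rw [intervalIntegral.integral_eq_sub_of_hasDerivAt hd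
    (by fun_prop : Continuous fun z => Real.exp (1 - z / x)).continuousOn.intervalIntegrable]
  ring

namespace Market

variable {B S : Type*} {M : Market B S}

/-- The difference of the logarithms is concave, nonnegative at `0` and zero at `x`, hence
nonnegative between them and nonpositive beyond `x`. -/
lemma IsMHR.exp_comparison (h : M.IsMHR) {i : B} {c k x : ℝ} (hc : 0 ≤ c) (hk : 0 < k)
    (hx : x ∈ Ioo 0 (M.pop i)) (hlx : M.lam i x = c + k)
    (hl0 : c + Real.exp 1 * k ≤ M.lam i 0) :
    (∀ z ∈ Icc 0 x, c + k * Real.exp (1 - z / x) ≤ M.lam i z) ∧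
    ∀ z ∈ Ico x (M.pop i), M.lam i z ≤ c + k * Real.exp (1 - z / x) := by
  have hx0 := hx.1
  have hpos : ∀ z, 0 < c + k * Real.exp (1 - z / x) := fun z => by positivity
  have hD := (h.concaveOn_log i).sub
    ((convexOn_log_add_exp hc hk hx0).subset (subset_univ _) (convex_Ico 0 (M.pop i)))
  set D : ℝ → ℝ := (fun z => Real.log (M.lam i z)) -
    fun z => Real.log (c + k * Real.exp (1 - z / x)) with hDdef
  have hD0 : 0 ≤ D 0 := by
    simp only [hDdef, Pi.sub_apply, zero_div, sub_zero, sub_nonneg]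
    exact Real.log_le_log (by positivity) (by linarith)
  have hDx : D x = 0 := by
    simp [hDdef, hlx, div_self hx0.ne']
  constructor
  · intro z hz
    have hzm : z ∈ Ico 0 (M.pop i) := ⟨hz.1, hz.2.trans_lt hx.2⟩
    have := hD.2 (M.zero_mem i) (Ioo_subset_Ico_self hx)
      (show 0 ≤ 1 - z / x by rw [sub_nonneg, div_le_one hx0]; exact hz.2)
      (show 0 ≤ z / x from div_nonneg hz.1 hx0.le) (by ring)
    simp only [smul_eq_mul, mul_zero, zero_add, div_mul_cancel₀ z hx0.ne', hDx, add_zero] at this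
    have h0 : 0 ≤ D z := this.trans' <| mul_nonneg
      (by rw [sub_nonneg, div_le_one hx0]; exact hz.2) hD0
    simp only [hDdef, Pi.sub_apply, sub_nonneg] at h0
    exact (Real.log_le_log_iff (hpos z) (M.lam_pos i z hzm)).1 h0
  · intro z hz
    have hz0 : 0 < z := hx0.trans_le hz.1
    have hzm : z ∈ Ico 0 (M.pop i) := ⟨hz0.le, hz.2⟩
    have h1 : 0 ≤ 1 - x / z := by rw [sub_nonneg, div_le_one hz0]; exact hz.1
    have := hD.2 (M.zero_mem i) hzm h1
      (show 0 ≤ x / z from div_nonneg hx0.le hz0.le) (by ring)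
    simp only [smul_eq_mul, mul_zero, zero_add, div_mul_cancel₀ x hz0.ne', hDx] at this
    have h0 : D z ≤ 0 := by
      have h2 := mul_nonneg h1 hD0
      have h3 : 0 < x / z := by positivity
      by_contra! h4
      have := mul_pos h3 h4
      linarith
    simp only [hDdef, Pi.sub_apply, sub_nonpos] at h0
    exact (Real.log_le_log_iff (M.lam_pos i z hzm) (hpos z)).1 h0

/-- The surplus at marginal cost `c` that a buyer type loses when the price is raised
from `c` until the stopping criterion is met is at most a fraction `1 / (e - 1)` of the surplus
that is kept. -/
lemma IsMHR.surplus_loss_le (h : M.IsMHR) {i : B} {c p l x u : ℝ} (hc : 0 ≤ c)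
    (hx : M.IsBestResponse i p x) (hu : u ∈ Icc 0 (M.pop i)) (hl : l ≤ M.lam i 0)
    (hp : c < l ∧ p = c + (l - c) / Real.exp 1 ∨ p = c) :
    (Real.exp 1 - 1) * ((∫ z in x..u, M.lam i z) - c * (u - x)) ≤
      (∫ z in (0 : ℝ)..x, M.lam i z) - c * x := by
  have he : 1 < Real.exp 1 := Real.one_lt_exp_iff.2 one_pos
  have hcp : c ≤ p := by
    rcases hp with ⟨h1, rfl⟩ | rfl
    · have : 0 ≤ (l - c) / Real.exp 1 := div_nonneg (by linarith) (by positivity)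
      linarith
    · exact le_rfl
  have hxu : ∀ v, 0 ≤ v → v ≤ x → c * (x - v) ≤ ∫ z in v..x, M.lam i z := fun v hv hvx =>
    M.le_integral_lam i hv hvx hx.2.1 fun z hz => hcp.trans (hx.2.2.1 z ⟨hv.trans hz.1.le, hz.2⟩)
  have hR : 0 ≤ (∫ z in (0 : ℝ)..x, M.lam i z) - c * x := by
    have := hxu 0 le_rfl hx.1
    simp only [sub_zero] at this
    linarith
  -- If `u ≤ x`, nothing is lost: the values below `x` are at least `p ≥ c`.
  rcases le_or_gt u x with hux | hux
  · have h1 := hxu u hu.1 hux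
    rw [intervalIntegral.integral_symm]
    refine hR.trans' (mul_nonpos_of_nonneg_of_nonpos (by linarith) ?_)
    linarith
  have hxT : x < M.pop i := hux.trans_le hu.2
  rcases hp with ⟨hcl, hpe⟩ | rfl
  swap
  · have := M.integral_lam_le i hx.1 hux.le hu.2
      fun z hz => hx.2.2.2 z ⟨hz.1, hz.2.trans_le hu.2⟩
    refine hR.trans' (mul_nonpos_of_nonneg_of_nonpos (by linarith) ?_)
    linarith
  set k := (l - c) / Real.exp 1 with hk
  have hk0 : 0 < k := div_pos (by linarith) (by positivity)
  have hkl : Real.exp 1 * k = l - c := by rw [hk]; field_simp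
  have hx0 : 0 < x := hx.pos (by nlinarith)
  have hlx : M.lam i x = c + k := hpe ▸ le_antisymm (hx.lam_le hxT) (hx.le_lam hx0 hxT)
  obtain ⟨hlow, hup⟩ := h.exp_comparison hc hk0 ⟨hx0, hxT⟩ hlx (by linarith)
  have hint : ∀ a b, IntervalIntegrable (fun z => c + k * Real.exp (1 - z / x))
      MeasureTheory.volume a b := fun a b =>
    (by fun_prop : Continuous fun z => c + k * Real.exp (1 - z / x)).intervalIntegrable a b
  have hval : ∀ a b, ∫ z in a..b, (c + k * Real.exp (1 - z / x)) =
      c * (b - a) + k * (x * (Real.exp (1 - a / x) - Real.exp (1 - b / x))) := fun a b => by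
    rw [intervalIntegral.integral_add (by simp)
      ((by fun_prop : Continuous fun z => k * Real.exp (1 - z / x)).intervalIntegrable a b),
      intervalIntegral.integral_const_mul, integral_exp_one_sub_div hx0]
    simp [mul_comm]
  have h1 := intervalIntegral.integral_mono_on_of_le_Ioo hx0.le (hint 0 x)
    (M.lam_intervalIntegrable i le_rfl (M.pop_pos i).le hx0.le hxT.le)
    fun z hz => hlow z (Ioo_subset_Icc_self hz)
  have h2 := intervalIntegral.integral_mono_on_of_le_Ioo hux.le
    (M.lam_intervalIntegrable i hx0.le hxT.le hu.1 hu.2) (hint x u)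
    fun z hz => hup z ⟨hz.1.le, hz.2.trans_le hu.2⟩
  rw [hval] at h1 h2
  simp only [zero_div, sub_zero, div_self hx0.ne', sub_self, Real.exp_zero] at h1 h2
  have h3 : 0 < k * x * Real.exp (1 - u / x) := by positivity
  -- The loss is at most `k * x` once the exponential tail is dropped, while `h1` says that at least
  -- `(e - 1) * k * x` is kept.
  have h4 : (∫ z in x..u, M.lam i z) - c * (u - x) ≤ k * x := by nlinarith
  have h5 := mul_le_mul_of_nonneg_left h4 (show 0 ≤ Real.exp 1 - 1 by linarith)
  nlinarith

end Market
end EnvyFreePricing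

namespace EnvyFreePricing

/-! ### Exchange arguments and perturbations of allocations -/

section Allocations

variable {B S : Type*} [Fintype B] [Fintype S]

lemma sum_supply (A : Finset S) (z : B → S → ℝ) :
    ∑ t ∈ A, supply z t = ∑ i, ∑ t ∈ A, z i t := by
  simp only [supply]; exact Finset.sum_comm

lemma supply_nonneg {z : B → S → ℝ} (hz : ∀ i t, 0 ≤ z i t) (t : S) : 0 ≤ supply z t :=
  Finset.sum_nonneg fun i _ => hz i t

lemma demand_nonneg {z : B → S → ℝ} (hz : ∀ i t, 0 ≤ z i t) (i : B) : 0 ≤ demand z i :=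
  Finset.sum_nonneg fun t _ => hz i t

lemma le_supply {z : B → S → ℝ} (hz : ∀ i t, 0 ≤ z i t) (i : B) (t : S) : z i t ≤ supply z t :=
  Finset.single_le_sum (f := fun i => z i t) (fun i _ => hz i t) (Finset.mem_univ i)

lemma le_demand {z : B → S → ℝ} (hz : ∀ i t, 0 ≤ z i t) (i : B) (t : S) : z i t ≤ demand z i :=
  Finset.single_le_sum (f := fun t => z i t) (fun t _ => hz i t) (Finset.mem_univ t)

lemma exists_pos_of_demand_pos {z : B → S → ℝ} {i : B} (h : 0 < demand z i) : ∃ t, 0 < z i t := by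
  by_contra! hle
  exact h.not_ge (Finset.sum_nonpos fun t _ => hle t)

/-- If the demand does not grow but more is bought from `A`, then some demand moves into `A`. -/
lemma exists_exchange {z z' : B → S → ℝ} {i : B} (hdem : demand z' i ≤ demand z i) {A : Finset S}
    (h : ∑ t ∈ A, z i t < ∑ t ∈ A, z' i t) :
    (∃ t ∈ A, z i t < z' i t) ∧ ∃ s ∉ A, z' i s < z i s := by
  classical
  refine ⟨Finset.exists_lt_of_sum_lt h, ?_⟩
  have h1 := Finset.sum_add_sum_compl A (z i)
  have h2 := Finset.sum_add_sum_compl A (z' i)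
  have h3 : ∑ t ∈ Aᶜ, z' i t < ∑ t ∈ Aᶜ, z i t := by
    simp only [demand] at hdem
    linarith
  obtain ⟨s, hs, hlt⟩ := Finset.exists_lt_of_sum_lt h3
  exact ⟨s, Finset.mem_compl.1 hs, hlt⟩

section Parametric

variable {c : S → ℝ → ℝ} {z z' : B → S → ℝ}

/-- In equilibrium flows, marginal costs fall when the demand falls. -/
lemma marginal_le_of_demand_le (hc : ∀ t, MonotoneOn (c t) (Ici 0)) (hz : ∀ i t, 0 ≤ z i t)
    (hz' : ∀ i t, 0 ≤ z' i t) (hdem : ∀ i, demand z' i ≤ demand z i)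
    (H : ∀ i t s, z i ≠ z' i → 0 < z' i t → 0 < z i s →
      c t (supply z' t) ≤ c s (supply z' s) ∧ c s (supply z s) ≤ c t (supply z t)) (t : S) :
    c t (supply z' t) ≤ c t (supply z t) := by
  classical
  by_contra! hlt
  -- The items that become dearer gain supply, so some buyer moves demand into this set from
  -- outside; equilibrium in both flows contradicts that.
  set A : Finset S := Finset.univ.filter fun t => c t (supply z t) < c t (supply z' t) with hA
  have hsup : ∀ t ∈ A, supply z t < supply z' t := fun t ht => by
    by_contra! hle
    exact (Finset.mem_filter.1 ht).2.not_ge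
      (hc t (supply_nonneg hz' t) (supply_nonneg hz t) hle)
  have h1 : ∑ t ∈ A, supply z t < ∑ t ∈ A, supply z' t :=
    Finset.sum_lt_sum_of_nonempty ⟨t, by simp [hA, hlt]⟩ hsup
  rw [sum_supply, sum_supply] at h1
  obtain ⟨i, -, hi⟩ := Finset.exists_lt_of_sum_lt h1
  obtain ⟨⟨a, ha, hza⟩, s, hs, hzs⟩ := exists_exchange (hdem i) hi
  obtain ⟨h2, h3⟩ := H i a s (fun h => hza.ne (congrFun h a)) ((hz i a).trans_lt hza)
    ((hz' i s).trans_lt hzs)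
  have h4 := (Finset.mem_filter.1 ha).2
  have h5 : ¬ c s (supply z s) < c s (supply z' s) := fun h => hs (by simp [hA, h])
  linarith

/-- In equilibrium flows, the supply of an item whose marginal cost falls does so by at most
the total fall of the demand. -/
lemma supply_sub_le_of_marginal_lt (hc : ∀ t, MonotoneOn (c t) (Ici 0)) (hz : ∀ i t, 0 ≤ z i t)
    (hz' : ∀ i t, 0 ≤ z' i t) (hdem : ∀ i, demand z' i ≤ demand z i)
    (H : ∀ i t s, z i ≠ z' i → 0 < z' i t → 0 < z i s →
      c t (supply z' t) ≤ c s (supply z' s) ∧ c s (supply z s) ≤ c t (supply z t)) {t : S}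
    (ht : c t (supply z' t) < c t (supply z t)) :
    supply z t - supply z' t ≤ ∑ i, (demand z i - demand z' i) := by
  classical
  set D : Finset S := Finset.univ.filter fun t => c t (supply z' t) < c t (supply z t) with hD
  have hmono := marginal_le_of_demand_le hc hz hz' hdem H
  have hsup : ∀ t ∈ D, 0 ≤ supply z t - supply z' t := fun t ht => by
    by_contra! hle
    exact (Finset.mem_filter.1 ht).2.not_ge
      (hc t (supply_nonneg hz t) (supply_nonneg hz' t) (by linarith))
  have h1 : supply z t - supply z' t ≤ ∑ t ∈ D, (supply z t - supply z' t) :=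
    Finset.single_le_sum hsup (by simp [hD, ht])
  refine h1.trans ?_
  rw [Finset.sum_sub_distrib, sum_supply, sum_supply, ← Finset.sum_sub_distrib]
  refine Finset.sum_le_sum fun i _ => ?_
  have h2 := Finset.sum_add_sum_compl D (z i)
  have h3 := Finset.sum_add_sum_compl D (z' i)
  -- No buyer moves demand from an item that becomes cheaper-at-the-margin less to one that does so
  -- more: purchases outside `D` cannot grow, so the drop inside `D` is paid for by the drop of the
  -- demand.
  have h4 : ∑ t ∈ Dᶜ, z' i t ≤ ∑ t ∈ Dᶜ, z i t := by
    by_contra! hlt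
    obtain ⟨⟨a, ha, hza⟩, s, hs, hzs⟩ := exists_exchange (hdem i) hlt
    obtain ⟨h2, h3⟩ := H i a s (fun h => hza.ne (congrFun h a)) ((hz i a).trans_lt hza)
      ((hz' i s).trans_lt hzs)
    have h4 : ¬ c a (supply z' a) < c a (supply z a) := fun h => by
      simp only [hD, Finset.mem_compl, Finset.mem_filter, Finset.mem_univ, true_and] at ha
      exact ha h
    have h5 : c s (supply z' s) < c s (supply z s) := by simpa [hD] using hs
    have := hmono a
    linarith
  simp only [demand]
  linarith

end Parametric

open Classical in
/-- Add `d` to the amount of item `t` given to type `i`. -/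
def bump (z : B → S → ℝ) (i : B) (t : S) (d : ℝ) : B → S → ℝ :=
  fun j r => z j r + if j = i then (if r = t then d else 0) else 0

open Classical in
lemma supply_bump (z : B → S → ℝ) (i : B) (t : S) (d : ℝ) (r : S) :
    supply (bump z i t d) r = supply z r + if r = t then d else 0 := by
  simp [supply, bump, Finset.sum_add_distrib]

open Classical in
lemma demand_bump (z : B → S → ℝ) (i : B) (t : S) (d : ℝ) (j : B) :
    demand (bump z i t d) j = demand z j + if j = i then d else 0 := by
  simp only [demand, bump, Finset.sum_add_distrib]
  by_cases h : j = i <;> simp [h]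

lemma bump_of_ne (z : B → S → ℝ) {i j : B} (h : j ≠ i) (t : S) (d : ℝ) :
    bump z i t d j = z j := by
  funext r; simp [bump, h]

lemma bump_self_of_ne (z : B → S → ℝ) (i : B) {t r : S} (h : r ≠ t) (d : ℝ) :
    bump z i t d i r = z i r := by
  simp [bump, h]

lemma bump_self (z : B → S → ℝ) (i : B) (t : S) (d : ℝ) : bump z i t d i t = z i t + d := by
  simp [bump]

lemma bump_nonneg {z : B → S → ℝ} (hz : ∀ i t, 0 ≤ z i t) {i : B} {t : S} {d : ℝ}
    (hd : 0 ≤ z i t + d) (j : B) (r : S) : 0 ≤ bump z i t d j r := by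
  by_cases hj : j = i
  · subst hj
    by_cases hr : r = t
    · subst hr; rwa [bump_self]
    · rw [bump_self_of_ne _ _ hr]; exact hz _ _
  · rw [bump_of_ne _ hj]; exact hz _ _

/-- Move `d` units of the demand of type `i` from item `t` to item `s`. -/
def shift (z : B → S → ℝ) (i : B) (t s : S) (d : ℝ) : B → S → ℝ :=
  bump (bump z i t (-d)) i s d

lemma demand_shift (z : B → S → ℝ) (i : B) (t s : S) (d : ℝ) (j : B) :
    demand (shift z i t s d) j = demand z j := by
  simp only [shift, demand_bump]
  split_ifs <;> ring

lemma shift_nonneg {z : B → S → ℝ} (hz : ∀ i t, 0 ≤ z i t) {i : B} {t s : S} (hts : s ≠ t) {d : ℝ}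
    (hd0 : 0 ≤ d) (hd : d ≤ z i t) (j : B) (r : S) : 0 ≤ shift z i t s d j r := by
  refine bump_nonneg (fun j r => bump_nonneg hz (by linarith) j r) ?_ j r
  rw [bump_self_of_ne _ _ hts]
  exact add_nonneg (hz i s) hd0

lemma continuous_supply (t : S) : Continuous fun z : B → S → ℝ => supply z t := by
  unfold supply; fun_prop

lemma continuous_demand (i : B) : Continuous fun z : B → S → ℝ => demand z i := by
  unfold demand; fun_prop

namespace Market

variable (M : Market B S)

/-- The tangent is taken at the new supply, so the bound holds for either sign of `d`. -/
lemma totalCost_bump_le {z : B → S → ℝ} (hz : ∀ t, 0 ≤ supply z t) {i : B} {t : S} {d : ℝ}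
    (hd : 0 ≤ supply z t + d) :
    M.totalCost (bump z i t d) ≤ M.totalCost z + M.mcost t (supply z t + d) * d := by
  classical
  have h : ∀ r, M.cost r (supply (bump z i t d) r) ≤
      M.cost r (supply z r) + if r = t then M.mcost t (supply z t + d) * d else 0 := by
    intro r
    rw [supply_bump]
    split_ifs with h
    · subst h
      have := M.cost_support r (hz r) hd
      linarith
    · simp
  refine (Finset.sum_le_sum fun r _ => h r).trans_eq ?_
  simp [Finset.sum_add_distrib, totalCost]

lemma totalCost_shift_le {z : B → S → ℝ} (hz : ∀ i t, 0 ≤ z i t) {i : B} {t s : S} (hts : s ≠ t)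
    {d : ℝ} (hd0 : 0 ≤ d) (hd : d ≤ z i t) :
    M.totalCost (shift z i t s d) ≤ M.totalCost z +
      d * (M.mcost s (supply z s + d) - M.mcost t (supply z t - d)) := by
  have h1 : 0 ≤ supply z t + -d := by linarith [le_supply hz i t]
  have hb := bump_nonneg hz (i := i) (t := t) (d := -d) (by linarith)
  have hs : supply (bump z i t (-d)) s = supply z s := by simp [supply_bump, hts]
  have h2 := M.totalCost_bump_le (supply_nonneg hz) (i := i) h1
  have h3 := M.totalCost_bump_le (supply_nonneg hb) (i := i) (t := s) (d := d)
    (add_nonneg (supply_nonneg hb s) hd0)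
  rw [hs] at h3
  rw [← sub_eq_add_neg] at h2
  simp only [shift]
  linarith

lemma mcost_le_of_forall_sub {t : S} {a δ K : ℝ} (hδ : 0 < δ) (hδa : δ ≤ a)
    (h : ∀ ε ∈ Ioo 0 δ, M.mcost t (a - ε) ≤ K) : M.mcost t a ≤ K := by
  by_contra! hK
  have hc := (M.mcost_continuousOn t a (hδ.le.trans hδa)).mono
    (fun x (hx : x ∈ Ioo (a - δ) a) => (mem_Ici.2 (by linarith [hx.1]) : x ∈ Ici (0 : ℝ)))
  have : (nhdsWithin a (Ioo (a - δ) a)).NeBot := by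
    rw [nhdsWithin_Ioo_eq_nhdsLT (by linarith)]; infer_instance
  obtain ⟨z, hz, hz2⟩ := ((hc.eventually (lt_mem_nhds hK)).and self_mem_nhdsWithin).exists
  have := h (a - z) ⟨by linarith [hz2.2], by linarith [hz2.1]⟩
  rw [sub_sub_cancel] at this
  linarith

lemma le_mcost_of_forall_add {t : S} {a δ K : ℝ} (hδ : 0 < δ) (ha : 0 ≤ a)
    (h : ∀ ε ∈ Ioo 0 δ, K ≤ M.mcost t (a + ε)) : K ≤ M.mcost t a := by
  by_contra! hK
  have hc := (M.mcost_continuousOn t a ha).mono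
    (fun x (hx : x ∈ Ioo a (a + δ)) => (mem_Ici.2 (by linarith [hx.1]) : x ∈ Ici (0 : ℝ)))
  have : (nhdsWithin a (Ioo a (a + δ))).NeBot := by
    rw [nhdsWithin_Ioo_eq_nhdsGT (by linarith)]; infer_instance
  obtain ⟨z, hz, hz2⟩ := ((hc.eventually (gt_mem_nhds hK)).and self_mem_nhdsWithin).exists
  have := h (z - a) ⟨by linarith [hz2.1], by linarith [hz2.2]⟩
  rw [add_sub_cancel] at this
  linarith

/-- First-order condition: an allocation whose cost cannot be lowered by moving demand
of type `i` from item `t` to item `s`. -/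
lemma mcost_le_of_shift {z : B → S → ℝ} (hz : ∀ i t, 0 ≤ z i t) {i : B} {t s : S} (ht : 0 < z i t)
    (h : s ≠ t → ∀ d ∈ Ioo 0 (z i t), M.totalCost z ≤ M.totalCost (shift z i t s d)) :
    M.mcost t (supply z t) ≤ M.mcost s (supply z s) := by
  rcases eq_or_ne s t with rfl | hts
  · exact le_rfl
  have hle := le_supply hz i t
  -- Two limits are taken: the supply of `s` is perturbed by a fixed `ε`, that of `t` by `d < ε`,
  -- and monotonicity compares the two perturbations of `s`.
  refine M.le_mcost_of_forall_add ht (supply_nonneg hz s) fun ε hε => ?_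
  refine M.mcost_le_of_forall_sub hε.1 (hε.2.le.trans hle) fun d hd => ?_
  have hdz : d ∈ Ioo 0 (z i t) := ⟨hd.1, hd.2.trans hε.2⟩
  have h1 := (h hts d hdz).trans (M.totalCost_shift_le hz hts hdz.1.le hdz.2.le)
  have h2 : 0 ≤ d * (M.mcost s (supply z s + d) - M.mcost t (supply z t - d)) := by linarith
  have h3 := nonneg_of_mul_nonneg_right h2 hd.1
  have hs := supply_nonneg hz s
  have h4 := M.mcost_monotoneOn s (a := supply z s + d) (b := supply z s + ε)
    (mem_Ici.2 (by linarith [hd.1])) (mem_Ici.2 (by linarith [hε.1])) (by linarith [hd.2])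
  linarith

/-! ### Existence of optimal allocations -/

lemma continuousOn_totalCost :
    ContinuousOn M.totalCost {z : B → S → ℝ | ∀ i t, 0 ≤ z i t} := by
  unfold totalCost
  refine continuousOn_finsetSum _ fun t _ => ?_
  exact (M.cost_continuousOn t).comp (continuous_supply t).continuousOn
    fun z hz => supply_nonneg hz t

lemma continuousOn_welfare : ContinuousOn M.welfare {z | M.IsFeasible z} := by
  unfold welfare
  refine ContinuousOn.sub (continuousOn_finsetSum _ fun i _ => ?_)
    (M.continuousOn_totalCost.mono fun z hz => hz.1)
  have hint : MeasureTheory.IntegrableOn (M.lam i) (uIcc 0 (M.pop i)) := by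
    have := M.lam_intervalIntegrable i le_rfl (M.pop_pos i).le (M.pop_pos i).le le_rfl
    rw [uIcc_of_le (M.pop_pos i).le, integrableOn_Icc_iff_integrableOn_Ioc]
    exact (intervalIntegrable_iff_integrableOn_Ioc_of_le (M.pop_pos i).le).1 this
  refine (intervalIntegral.continuousOn_primitive_interval hint).comp
    (continuous_demand i).continuousOn fun z hz => ?_
  rw [uIcc_of_le (M.pop_pos i).le]
  exact ⟨demand_nonneg hz.1 i, hz.2.2 i⟩

lemma exists_min_of_isClosed {K : Set (B → S → ℝ)} (hK : IsClosed K) (hne : K.Nonempty)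
    (hsub : ∀ z ∈ K, (∀ i t, 0 ≤ z i t) ∧ ∀ i, demand z i ≤ M.pop i) {f : (B → S → ℝ) → ℝ}
    (hf : ContinuousOn f K) : ∃ z ∈ K, ∀ w ∈ K, f z ≤ f w := by
  have hc : IsCompact K := by
    refine (isCompact_Icc (a := (0 : B → S → ℝ)) (b := fun i _ => M.pop i)).of_isClosed_subset hK
      fun z hz => ⟨fun i t => (hsub z hz).1 i t, fun i t => ?_⟩
    exact (le_demand (hsub z hz).1 i t).trans ((hsub z hz).2 i)
  exact hc.exists_isMinOn hne hf

lemma isFeasible_zero : M.IsFeasible (fun _ _ => 0) :=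
  ⟨fun _ _ => le_rfl, fun _ _ _ => rfl, fun i => by simp [demand, (M.pop_pos i).le]⟩

lemma isClosed_isFeasible : IsClosed {z | M.IsFeasible z} := by
  have h1 : IsClosed {z : B → S → ℝ | ∀ i t, 0 ≤ z i t} := by
    simp only [ofPred_forall]
    exact isClosed_iInter fun i => isClosed_iInter fun t =>
      isClosed_le continuous_const (by fun_prop)
  have h2 : IsClosed {z : B → S → ℝ | ∀ i t, t ∉ M.items i → z i t = 0} := by
    simp only [ofPred_forall]
    exact isClosed_iInter fun i => isClosed_iInter fun t => isClosed_iInter fun _ =>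
      isClosed_eq (by fun_prop) continuous_const
  have h3 : IsClosed {z : B → S → ℝ | ∀ i, demand z i ≤ M.pop i} := by
    simp only [ofPred_forall]
    exact isClosed_iInter fun i => isClosed_le (continuous_demand i) continuous_const
  exact h1.inter (h2.inter h3)

lemma exists_isWelfareOptimal : ∃ y, M.IsWelfareOptimal y := by
  obtain ⟨y, hy, hmin⟩ := M.exists_min_of_isClosed M.isClosed_isFeasible ⟨_, M.isFeasible_zero⟩
    (fun z hz => ⟨hz.1, hz.2.2⟩) M.continuousOn_welfare.neg
  exact ⟨y, hy, fun z hz => neg_le_neg_iff.1 (hmin z hz)⟩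

/-! ### First-order conditions for the welfare optimum -/

variable {M}

lemma welfare_bump_ge {z : B → S → ℝ} (hz : M.IsFeasible z) {i : B} {t : S} {d : ℝ}
    (hd : 0 ≤ supply z t + d) (hx0 : 0 ≤ demand z i + d) (hxT : demand z i + d ≤ M.pop i) :
    M.welfare z + (∫ x in demand z i..demand z i + d, M.lam i x)
      - M.mcost t (supply z t + d) * d ≤ M.welfare (bump z i t d) := by
  classical
  have h1 := M.totalCost_bump_le (supply_nonneg hz.1) (i := i) hd
  have h2 : (∑ j, ∫ x in (0 : ℝ)..demand (bump z i t d) j, M.lam j x) =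
      (∑ j, ∫ x in (0 : ℝ)..demand z j, M.lam j x) +
        ∫ x in demand z i..demand z i + d, M.lam i x := by
    have h3 : ∀ j, (∫ x in (0 : ℝ)..demand (bump z i t d) j, M.lam j x) =
        (∫ x in (0 : ℝ)..demand z j, M.lam j x) +
          if j = i then ∫ x in demand z i..demand z i + d, M.lam i x else 0 := by
      intro j
      rw [demand_bump]
      split_ifs with h
      · subst h
        rw [← M.integral_lam_sub j (demand_nonneg hz.1 j) (hz.2.2 j) hx0 hxT]
        ring
      · simp
    simp only [h3, Finset.sum_add_distrib, Finset.sum_ite_eq', Finset.mem_univ, if_true]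
  simp only [welfare, h2]
  linarith

lemma isFeasible_bump {z : B → S → ℝ} (hz : M.IsFeasible z) {i : B} {t : S} {d : ℝ}
    (ht : t ∈ M.items i) (hd : 0 ≤ z i t + d) (hxT : demand z i + d ≤ M.pop i) :
    M.IsFeasible (bump z i t d) := by
  refine ⟨bump_nonneg hz.1 hd, fun j r hr => ?_, fun j => ?_⟩
  · by_cases hj : j = i
    · subst hj
      rw [bump_self_of_ne _ _ (fun h : r = t => hr (h.symm ▸ ht))]
      exact hz.2.1 _ _ hr
    · rw [bump_of_ne _ hj]
      exact hz.2.1 _ _ hr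
  · rw [demand_bump]
    split_ifs with h
    · subst h; exact hxT
    · simpa using hz.2.2 j

lemma IsFeasible.mem_items {z : B → S → ℝ} (hz : M.IsFeasible z) {i : B} {t : S} (h : 0 < z i t) :
    t ∈ M.items i := by
  by_contra hn
  exact h.ne' (hz.2.1 i t hn)

lemma isFeasible_shift {z : B → S → ℝ} (hz : M.IsFeasible z) {i : B} {t s : S} (hts : s ≠ t)
    {d : ℝ} (ht : t ∈ M.items i) (hs : s ∈ M.items i) (hd0 : 0 ≤ d) (hd : d ≤ z i t) :
    M.IsFeasible (shift z i t s d) := by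
  have h1 : M.IsFeasible (bump z i t (-d)) :=
    isFeasible_bump hz ht (by linarith) (by linarith [hz.2.2 i])
  refine isFeasible_bump h1 hs (by rw [bump_self_of_ne _ _ hts]; exact add_nonneg (hz.1 i s) hd0) ?_
  rw [demand_bump, if_pos rfl]
  linarith [hz.2.2 i]

lemma IsWelfareOptimal.mcost_le {y : B → S → ℝ} (hy : M.IsWelfareOptimal y) {i : B} {t s : S}
    (ht : 0 < y i t) (hs : s ∈ M.items i) :
    M.mcost t (supply y t) ≤ M.mcost s (supply y s) := by
  refine M.mcost_le_of_shift hy.1.1 ht fun hts d hd => ?_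
  have := hy.2 _ (isFeasible_shift hy.1 hts (hy.1.mem_items ht) hs hd.1.le hd.2.le)
  simp only [welfare, demand_shift] at this
  linarith

lemma minPrice_le {p : S → ℝ} {i : B} {t : S} (ht : t ∈ M.items i) : M.minPrice p i ≤ p t :=
  Finset.inf'_le p ht

lemma le_minPrice {p : S → ℝ} {i : B} {q : ℝ} (h : ∀ t ∈ M.items i, q ≤ p t) :
    q ≤ M.minPrice p i :=
  Finset.le_inf' _ _ h

lemma exists_minPrice (p : S → ℝ) (i : B) : ∃ t ∈ M.items i, M.minPrice p i = p t :=
  Finset.exists_mem_eq_inf' _ _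

lemma IsWelfareOptimal.isEnvyFree {y : B → S → ℝ} (hy : M.IsWelfareOptimal y) :
    M.IsEnvyFree ⟨fun t => M.mcost t (supply y t), y⟩ := by
  have huse : ∀ i t, 0 < y i t →
      M.mcost t (supply y t) = M.minPrice (fun t => M.mcost t (supply y t)) i := fun i t ht =>
    le_antisymm (le_minPrice fun s hs => hy.mcost_le ht hs) (minPrice_le (hy.1.mem_items ht))
  refine ⟨hy.1, fun i => ⟨demand_nonneg hy.1.1 i, hy.1.2.2 i, fun z hz => ?_, fun z hz => ?_⟩, huse⟩
  · obtain ⟨t, ht⟩ := exists_pos_of_demand_pos (hz.1.trans_lt hz.2)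
    simp only at hz ⊢
    rw [← huse i t ht]
    have hle := le_supply hy.1.1 i t
    have hle' := le_demand hy.1.1 i t
    -- The first bound keeps the reduced allocation nonnegative; the second keeps `z` below the
    -- reduced demand, so every removed unit has value at most `M.lam i z`.
    refine M.mcost_le_of_forall_sub (δ := min (y i t) (demand y i - z))
      (lt_min ht (by linarith [hz.2])) ((min_le_left _ _).trans hle) fun ε hε => ?_
    have hε1 := hε.2.trans_le (min_le_left _ _)
    have hε2 := hε.2.trans_le (min_le_right _ _)
    have hT := hy.1.2.2 i
    have h1 := hy.2 _ (isFeasible_bump hy.1 (d := -ε) (hy.1.mem_items ht) (by linarith)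
      (by linarith [hε.1]))
    have h2 := welfare_bump_ge hy.1 (i := i) (t := t) (d := -ε) (by linarith) (by linarith)
      (by linarith [hε.1])
    have h3 := M.integral_lam_le i (a := demand y i + -ε) (b := demand y i) (K := M.lam i z)
      (by linarith) (by linarith [hε.1]) hT
      fun w hw => M.lam_antitone i ⟨hz.1, by linarith [hz.2]⟩
        ⟨by linarith [hw.1, hz.1], by linarith [hw.2]⟩ (by linarith [hw.1])
    rw [intervalIntegral.integral_symm] at h2
    rw [sub_eq_add_neg]
    have h4 : 0 ≤ ε * (M.lam i z - M.mcost t (supply y t + -ε)) := by linarith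
    linarith [nonneg_of_mul_nonneg_right h4 hε.1]
  · obtain ⟨t, ht, hmin⟩ := exists_minPrice (M := M) (fun t => M.mcost t (supply y t)) i
    simp only at hz ⊢
    rw [hmin]
    have hx0 := demand_nonneg hy.1.1 i
    refine M.le_mcost_of_forall_add (δ := z - demand y i) (by linarith [hz.1])
      (supply_nonneg hy.1.1 t) fun ε hε => ?_
    have hT := hz.2
    have hs := supply_nonneg hy.1.1 t
    have h1 := hy.2 _ (isFeasible_bump hy.1 (d := ε) ht (add_nonneg (hy.1.1 i t) hε.1.le)
      (by linarith [hε.2]))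
    have h2 := welfare_bump_ge hy.1 (i := i) (t := t) (d := ε) (by linarith [hε.1])
      (by linarith [hε.1]) (by linarith [hε.2])
    have h3 := M.le_integral_lam i (a := demand y i) (b := demand y i + ε) (K := M.lam i z)
      hx0 (by linarith [hε.1]) (by linarith [hε.2])
      fun w hw => M.lam_antitone i ⟨by linarith [hw.1], by linarith [hw.2, hε.2]⟩
        ⟨by linarith [hw.1, hε.1, hε.2], hz.2⟩ (by linarith [hw.2, hε.2])
    have h4 : 0 ≤ ε * (M.mcost t (supply y t + ε) - M.lam i z) := by linarith
    linarith [nonneg_of_mul_nonneg_right h4 hε.1]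

end Market
end Allocations
end EnvyFreePricing

namespace EnvyFreePricing
namespace Market

variable {B S : Type*} [Fintype B] [Fintype S] {M : Market B S}

/-! ### Equilibrium flows on the active sub-graph -/

/-- When `c` falls, the margin `p - c` grows faster than `(l - c) / k`. -/
lemma MeetsCriterion.anti {k l p c c' : ℝ} (hk : 1 < k) (h : MeetsCriterion k l p c)
    (hc : c' ≤ c) : MeetsCriterion k l p c' := by
  unfold MeetsCriterion at *
  have : 1 / k * (c - c') ≤ 1 * (c - c') :=
    mul_le_mul_of_nonneg_right ((div_le_one (by linarith)).2 hk.le) (by linarith)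
  linarith

variable (M) in
/-- A flow on the active sub-graph for a best-response demand at price `q`, in which active buyer
types only use active items of minimal marginal cost. -/
def IsActiveEquilibrium (σ : AscState B S) (q : ℝ) (z : B → S → ℝ) : Prop :=
  M.IsActiveFlow σ z ∧
  (∀ i, σ.buyerStatus i = Status.active → M.IsBestResponse i q (demand z i)) ∧
  ∀ i, σ.buyerStatus i = Status.active → ∀ t s, 0 < z i t → s ∈ M.items i →
    σ.itemStatus s = Status.active → M.mcost t (supply z t) ≤ M.mcost s (supply z s)

section Flow

variable {σ : AscState B S} {z z' : B → S → ℝ} {q q' : ℝ}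

lemma IsActiveFlow.nonneg (h : M.IsActiveFlow σ z) (hσ : ∀ i t, 0 ≤ σ.alloc i t) (i : B) (t : S) :
    0 ≤ z i t := by
  by_cases hi : σ.buyerStatus i = Status.active
  · exact (h.2 i hi t).1
  · rw [h.1 i hi]; exact hσ i t

lemma IsActiveFlow.of_pos (h : M.IsActiveFlow σ z) {i : B} (hi : σ.buyerStatus i = Status.active)
    {t : S} (ht : 0 < z i t) : t ∈ M.items i ∧ σ.itemStatus t = Status.active := by
  by_contra hn
  refine ht.ne' ((h.2 i hi t).2 ?_)
  tauto

lemma IsActiveFlow.supply_eq (h : M.IsActiveFlow σ z) (h' : M.IsActiveFlow σ z') {t : S}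
    (ht : σ.itemStatus t ≠ Status.active) : supply z t = supply z' t := by
  refine Finset.sum_congr rfl fun i _ => ?_
  by_cases hi : σ.buyerStatus i = Status.active
  · rw [(h.2 i hi t).2 (Or.inr ht), (h'.2 i hi t).2 (Or.inr ht)]
  · rw [h.1 i hi, h'.1 i hi]

/-- Shifting demand of an active buyer between active items keeps the flow and its demand, so
minimality yields the first-order condition. -/
lemma IsActiveMinCost.isActiveEquilibrium (h : M.IsActiveMinCost σ q z)
    (hσ : ∀ i t, 0 ≤ σ.alloc i t) : M.IsActiveEquilibrium σ q z := by
  refine ⟨h.1, h.2.1, fun i hi t s ht hs hsa => ?_⟩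
  have hz := h.1.nonneg hσ
  obtain ⟨-, hta⟩ := h.1.of_pos hi ht
  refine M.mcost_le_of_shift hz ht fun hts d hd => ?_
  refine h.2.2 _ ⟨fun j hj => ?_, fun j hj r => ⟨?_, fun hr => ?_⟩⟩ (demand_shift z i t s d)
  · have hji : j ≠ i := fun e => hj (e ▸ hi)
    rw [shift, bump_of_ne _ hji, bump_of_ne _ hji, h.1.1 j hj]
  · exact shift_nonneg hz hts hd.1.le hd.2.le j r
  · by_cases hji : j = i
    · subst hji
      have hrs : r ≠ s := by rintro rfl; tauto
      have hrt : r ≠ t := by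
        rintro rfl
        exact ht.ne' ((h.1.2 j hj r).2 hr)
      rw [shift, bump_self_of_ne _ _ hrs, bump_self_of_ne _ _ hrt]
      exact (h.1.2 j hj r).2 hr
    · rw [shift, bump_of_ne _ hji, bump_of_ne _ hji]
      exact (h.1.2 j hj r).2 hr

lemma IsActiveEquilibrium.demand_le (h : M.IsActiveEquilibrium σ q z)
    (h' : M.IsActiveEquilibrium σ q' z') (hq : q < q') (i : B) : demand z' i ≤ demand z i := by
  by_cases hi : σ.buyerStatus i = Status.active
  · exact (h.2.1 i hi).anti (h'.2.1 i hi) hq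
  · simp only [demand, h.1.1 i hi, h'.1.1 i hi, le_refl]

lemma IsActiveEquilibrium.exchange (h : M.IsActiveEquilibrium σ q z)
    (h' : M.IsActiveEquilibrium σ q' z') (i : B) (t s : S) (hne : z i ≠ z' i) (ht : 0 < z' i t)
    (hs : 0 < z i s) : M.mcost t (supply z' t) ≤ M.mcost s (supply z' s) ∧
      M.mcost s (supply z s) ≤ M.mcost t (supply z t) := by
  have hi : σ.buyerStatus i = Status.active := by
    by_contra hi
    exact hne ((h.1.1 i hi).trans (h'.1.1 i hi).symm)
  obtain ⟨ht1, ht2⟩ := h'.1.of_pos hi ht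
  obtain ⟨hs1, hs2⟩ := h.1.of_pos hi hs
  exact ⟨h'.2.2 i hi t s ht hs1 hs2, h.2.2 i hi s t hs ht1 ht2⟩

lemma IsActiveEquilibrium.mcost_le (hσ : ∀ i t, 0 ≤ σ.alloc i t)
    (h : M.IsActiveEquilibrium σ q z) (h' : M.IsActiveEquilibrium σ q' z') (hq : q < q') (t : S) :
    M.mcost t (supply z' t) ≤ M.mcost t (supply z t) :=
  marginal_le_of_demand_le M.mcost_monotoneOn (h.1.nonneg hσ) (h'.1.nonneg hσ)
    (h.demand_le h' hq) (h.exchange h') t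

lemma IsActiveEquilibrium.supply_sub_le (hσ : ∀ i t, 0 ≤ σ.alloc i t)
    (h : M.IsActiveEquilibrium σ q z) (h' : M.IsActiveEquilibrium σ q' z') (hq : q < q') {t : S}
    (ht : M.mcost t (supply z' t) ≠ M.mcost t (supply z t)) :
    |supply z t - supply z' t| ≤ ∑ i, |demand z i - demand z' i| := by
  have hlt := lt_of_le_of_ne (h.mcost_le hσ h' hq t) ht
  have h1 := supply_sub_le_of_marginal_lt M.mcost_monotoneOn (h.1.nonneg hσ) (h'.1.nonneg hσ)
    (h.demand_le h' hq) (h.exchange h') hlt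
  have h2 : 0 ≤ supply z t - supply z' t := by
    by_contra! hle
    exact hlt.not_ge (M.mcost_monotoneOn t (supply_nonneg (h.1.nonneg hσ) t)
      (supply_nonneg (h'.1.nonneg hσ) t) (by linarith))
  rw [abs_of_nonneg h2]
  exact h1.trans (Finset.sum_le_sum fun i _ => le_abs_self _)

/-- Marginal costs in equilibrium flows depend continuously on the active price. -/
lemma IsActiveEquilibrium.mcost_continuous (hM : M.IsMHR) (hσ : ∀ i t, 0 ≤ σ.alloc i t)
    (h : M.IsActiveEquilibrium σ q z) (hq : ∀ i, q < M.lam i 0) (t : S) {ε : ℝ} (hε : 0 < ε) :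
    ∃ δ > 0, ∀ r w, |r - q| < δ → r ≠ q → M.IsActiveEquilibrium σ r w →
      |M.mcost t (supply w t) - M.mcost t (supply z t)| < ε := by
  obtain ⟨η, hη, H⟩ := Metric.continuousOn_iff.1 (M.mcost_continuousOn t) (supply z t)
    (supply_nonneg (h.1.nonneg hσ) t) ε hε
  -- The extra one makes the sum over all buyers strictly less than `η`, also when there are none.
  have hη' : 0 < η / (Fintype.card B + 1) := by positivity
  have hex : ∀ i, ∃ δ > 0, ∀ r w, |r - q| < δ → M.IsActiveEquilibrium σ r w →
      |demand w i - demand z i| ≤ η / (Fintype.card B + 1) := by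
    intro i
    by_cases hi : σ.buyerStatus i = Status.active
    · obtain ⟨δ, hδ, h1⟩ := hM.bestResponse_continuous (hq i) (h.2.1 i hi) hη'
      exact ⟨δ, hδ, fun r w hr hw => (h1 r _ hr (hw.2.1 i hi)).le⟩
    · refine ⟨1, one_pos, fun r w _ hw => ?_⟩
      simp only [demand, h.1.1 i hi, hw.1.1 i hi, sub_self, abs_zero]
      exact hη'.le
  choose δ hδ hδ' using hex
  obtain ⟨d, hd, hdle⟩ : ∃ d > 0, ∀ i, d ≤ δ i := by
    rcases isEmpty_or_nonempty B with hB | hB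
    · exact ⟨1, one_pos, fun i => hB.elim i⟩
    · obtain ⟨i, hi⟩ := Finite.exists_min δ
      exact ⟨δ i, hδ i, hi⟩
  refine ⟨d, hd, fun r w hr hrq hw => ?_⟩
  by_cases heq : M.mcost t (supply w t) = M.mcost t (supply z t)
  · rwa [heq, sub_self, abs_zero]
  have hsum : ∑ i, |demand w i - demand z i| < η := by
    calc ∑ i, |demand w i - demand z i| ≤ ∑ _i : B, η / (Fintype.card B + 1) :=
          Finset.sum_le_sum fun i _ => hδ' i r w (hr.trans_le (hdle i)) hw
      _ < η := by
          rw [Finset.sum_const, Finset.card_univ, nsmul_eq_mul, mul_div_assoc', div_lt_iff₀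
            (by positivity)]
          linarith
  have hsup : |supply w t - supply z t| < η := by
    rcases lt_or_gt_of_ne hrq with hlt | hlt
    · exact (hw.supply_sub_le hσ h hlt (Ne.symm heq)).trans_lt hsum
    · rw [abs_sub_comm]
      refine (h.supply_sub_le hσ hw hlt heq).trans_lt (hsum.trans_eq' ?_)
      exact Finset.sum_congr rfl fun i _ => abs_sub_comm _ _
  exact H (supply w t) (supply_nonneg (hw.1.nonneg hσ) t) hsup

end Flow

/-! ### The invariant of the ascending-price procedure -/

/-- Invariant of the ascending-price procedure started from the welfare optimum `y`. -/
structure AscInv (M : Market B S) (k l : ℝ) (y : B → S → ℝ) (σ : AscState B S) : Prop where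
  envyFree : M.IsEnvyFree ⟨σ.price, σ.alloc⟩
  active_price : ∀ t, σ.itemStatus t = Status.active → σ.price t = σ.clock
  inactive_price : ∀ t, σ.itemStatus t = Status.inactive →
    σ.clock ≤ σ.price t ∧ σ.price t = M.mcost t (supply y t)
  finished_price : ∀ t, σ.itemStatus t = Status.finished →
    σ.price t ≤ σ.clock ∧ MeetsCriterion k l (σ.price t) (M.mcost t (supply σ.alloc t))
  start_le : ∀ t, M.mcost t (supply y t) ≤ σ.price t
  -- An item whose price has not risen yet still has its initial supply; this links the current
  -- state to the optimality of `y` when an item becomes active.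
  supply_eq : ∀ t, σ.price t = M.mcost t (supply y t) → supply σ.alloc t = supply y t
  mcost_le : ∀ t, M.mcost t (supply σ.alloc t) ≤ σ.price t
  price_le : ∀ t, σ.price t = M.mcost t (supply σ.alloc t) ∨
    σ.price t < l ∧ σ.price t ≤
      M.mcost t (supply σ.alloc t) + 1 / k * (l - M.mcost t (supply σ.alloc t))
  inactive_buyer : ∀ i, σ.buyerStatus i = Status.inactive →
    σ.alloc i = y i ∧ ∀ t, 0 < σ.alloc i t → σ.itemStatus t = Status.inactive
  active_demand : ∀ i, σ.buyerStatus i = Status.active → 0 < demand σ.alloc i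
  active_use : ∀ i, σ.buyerStatus i = Status.active → ∀ t, 0 < σ.alloc i t →
    σ.itemStatus t ≠ Status.finished ∧ σ.price t = σ.clock
  -- The comparison covers all items priced at the clock, whatever their status, since an activation
  -- or a finish may be pending there.
  active_mcost : ∀ i, σ.buyerStatus i = Status.active → ∀ t s, 0 < σ.alloc i t → s ∈ M.items i →
    σ.price s = σ.clock → M.mcost t (supply σ.alloc t) ≤ M.mcost s (supply σ.alloc s)
  -- A buyer can be frozen while using items that are not finished yet; these already meet the
  -- criterion and must finish before the next rise.
  finished_use : ∀ i, σ.buyerStatus i = Status.finished → ∀ t, 0 < σ.alloc i t →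
    σ.itemStatus t = Status.finished ∨
      σ.price t = σ.clock ∧ MeetsCriterion k l (σ.price t) (M.mcost t (supply σ.alloc t))

namespace AscInv

variable {k l : ℝ} {y : B → S → ℝ} {σ : AscState B S}

lemma init [Nonempty S] (hy : M.IsWelfareOptimal y) : M.AscInv k l y (M.ascInit y) := by
  have hmin : ∀ t, (⨅ t', M.mcost t' (supply y t')) ≤ M.mcost t (supply y t) :=
    fun t => ciInf_le (Finite.bddBelow_range _) t
  have hact : ∀ i, (M.ascInit y).buyerStatus i = Status.active →
      ∃ t, M.mcost t (supply y t) = (⨅ t', M.mcost t' (supply y t')) ∧ 0 < y i t := by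
    intro i hi
    by_contra hn
    simp [ascInit, hn] at hi
  have hnf : ∀ t, (M.ascInit y).itemStatus t ≠ Status.finished := by
    intro t
    simp only [ascInit]
    split_ifs <;> simp
  have hnfb : ∀ i, (M.ascInit y).buyerStatus i ≠ Status.finished := by
    intro i
    simp only [ascInit]
    split_ifs <;> simp
  refine ⟨hy.isEnvyFree, fun t ht => ?_, fun t _ => ⟨hmin t, rfl⟩, fun t ht => absurd ht (hnf t),
    fun _ => le_rfl, fun _ _ => rfl, fun _ => le_rfl, fun _ => Or.inl rfl,
    fun i hi => ⟨rfl, fun t ht => ?_⟩, fun i hi => ?_, fun i hi t ht => ⟨hnf t, ?_⟩,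
    fun i hi t s ht hs _ => hy.mcost_le ht hs, fun i hi => absurd hi (hnfb i)⟩
  · by_contra hn
    have hn' : ¬ M.mcost t (supply y t) = ⨅ t', M.mcost t' (supply y t') := hn
    simp [ascInit, hn'] at ht
  · have hne : ¬ M.mcost t (supply y t) = ⨅ t', M.mcost t' (supply y t') := by
      intro h
      have : ∃ t, M.mcost t (supply y t) = (⨅ t', M.mcost t' (supply y t')) ∧ 0 < y i t :=
        ⟨t, h, ht⟩
      simp [ascInit, this] at hi
    simp [ascInit, hne]
  · obtain ⟨t, -, ht⟩ := hact i hi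
    exact ht.trans_le (le_demand hy.1.1 i t)
  · obtain ⟨s, hs, hs'⟩ := hact i hi
    exact le_antisymm ((hy.mcost_le ht (hy.1.mem_items hs')).trans_eq hs) (hmin t)

lemma alloc_nonneg (h : M.AscInv k l y σ) : ∀ i t, 0 ≤ σ.alloc i t := h.envyFree.1.1

lemma minPrice_eq (h : M.AscInv k l y σ) {i : B} (hi : σ.buyerStatus i = Status.active) :
    M.minPrice σ.price i = σ.clock := by
  obtain ⟨t, ht⟩ := exists_pos_of_demand_pos (h.active_demand i hi)
  rw [← (h.active_use i hi t ht).2]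
  exact (h.envyFree.2.2 i t ht).symm

section Raise

variable (h : M.AscInv k l y σ)
  (hin : ∀ t, σ.itemStatus t = Status.inactive → σ.clock < σ.price t)
  (hnm : ∀ t, σ.itemStatus t = Status.active →
    ¬ MeetsCriterion k l σ.clock (M.mcost t (supply σ.alloc t)))

include h hin

lemma use_active {i : B} (hi : σ.buyerStatus i = Status.active) {t : S} (ht : 0 < σ.alloc i t) :
    σ.itemStatus t = Status.active := by
  obtain ⟨h1, h2⟩ := h.active_use i hi t ht
  cases hs : σ.itemStatus t with
  | inactive => exact absurd h2 (hin t hs).ne'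
  | active => rfl
  | finished => exact absurd hs h1

lemma isActiveEquilibrium : M.IsActiveEquilibrium σ σ.clock σ.alloc := by
  refine ⟨⟨fun _ _ => rfl, fun i hi t => ⟨h.alloc_nonneg i t, fun ht => ?_⟩⟩, fun i hi => ?_,
    fun i hi t s ht hs hsa => h.active_mcost i hi t s ht hs (h.active_price s hsa)⟩
  · by_contra hne
    have hpos := (h.alloc_nonneg i t).lt_of_ne (Ne.symm hne)
    have := h.use_active hin hi hpos
    have := h.envyFree.1.mem_items hpos
    tauto
  · rw [← h.minPrice_eq hi]
    exact h.envyFree.2.1 i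

include hnm

/-- A finished item in the demand set would be priced exactly at the clock; the items that the buyer
uses have no larger marginal cost, so they would meet the criterion too. -/
lemma not_finished (hk : 1 < k) {i : B} (hi : σ.buyerStatus i = Status.active) {s : S}
    (hs : s ∈ M.items i) : σ.itemStatus s ≠ Status.finished := by
  intro hsf
  obtain ⟨t, ht⟩ := exists_pos_of_demand_pos (h.active_demand i hi)
  have hta := h.use_active hin hi ht
  obtain ⟨h1, h2⟩ := h.finished_price s hsf
  have h3 : σ.clock ≤ σ.price s := h.minPrice_eq hi ▸ minPrice_le hs
  have h4 := le_antisymm h1 h3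
  refine hnm t hta ?_
  rw [h4] at h2
  exact h2.anti hk (h.active_mcost i hi t s ht hs h4)

lemma use_finished {i : B} (hi : σ.buyerStatus i = Status.finished) {t : S}
    (ht : 0 < σ.alloc i t) : σ.itemStatus t = Status.finished := by
  rcases h.finished_use i hi t ht with h1 | ⟨h1, h2⟩
  · exact h1
  · cases hs : σ.itemStatus t with
    | inactive => exact absurd h1 (hin t hs).ne'
    | active => rw [h1] at h2; exact absurd h2 (hnm t hs)
    | finished => rfl

omit hin in
-- At a price of at least `l` the criterion holds automatically, as the marginal cost does not
-- exceed the price.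
lemma clock_lt (hk : 1 < k) {t : S} (ht : σ.itemStatus t = Status.active) : σ.clock < l := by
  have h1 := h.mcost_le t
  have h2 := hnm t ht
  rw [h.active_price t ht] at h1
  unfold MeetsCriterion at h2
  push Not at h2
  by_contra! hle
  have h3 : 1 / k * (l - M.mcost t (supply σ.alloc t)) ≤
      1 / k * (σ.clock - M.mcost t (supply σ.alloc t)) :=
    mul_le_mul_of_nonneg_left (by linarith) (by positivity)
  have h4 : 1 / k * (σ.clock - M.mcost t (supply σ.alloc t)) ≤
      1 * (σ.clock - M.mcost t (supply σ.alloc t)) :=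
    mul_le_mul_of_nonneg_right ((div_le_one (by linarith)).2 hk.le) (by linarith)
  linarith

end Raise

end AscInv
end Market
end EnvyFreePricing

/-! ### Preservation of the invariant by the steps of the procedure -/

namespace EnvyFreePricing
namespace Market

variable {B S : Type*} [Fintype B] [Fintype S] {M : Market B S}

namespace AscInv

variable {k l : ℝ} {y : B → S → ℝ} {σ : AscState B S}

/-- If the stopping criterion is not met before the price `q` is reached, then it is met at `q`
with equality at most. -/
lemma price_le_of_not_met (h : M.AscInv k l y σ) (hM : M.IsMHR) (hl : ∀ i, l ≤ M.lam i 0)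
    (hk : 1 < k) {q : ℝ} {path : ℝ → B → S → ℝ} (hq : σ.clock < q)
    (hin : ∀ t, σ.itemStatus t = Status.inactive → σ.clock < σ.price t)
    (hstart : path σ.clock = σ.alloc)
    (hpath : ∀ r ∈ Ioc σ.clock q, M.IsActiveMinCost σ r (path r))
    (hnm : ∀ r ∈ Ico σ.clock q, ∀ t, σ.itemStatus t = Status.active →
      ¬ MeetsCriterion k l r (M.mcost t (supply (path r) t)))
    {t : S} (ht : σ.itemStatus t = Status.active) :
    q < l ∧ q ≤ M.mcost t (supply (path q) t) +
      1 / k * (l - M.mcost t (supply (path q) t)) := by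
  have hσ := h.alloc_nonneg
  have hk1 : 1 / k < 1 := (div_lt_one (by linarith)).2 hk
  have hk0 : 0 < 1 / k := by positivity
  have heq : ∀ r ∈ Icc σ.clock q, M.IsActiveEquilibrium σ r (path r) := fun r hr => by
    rcases hr.1.eq_or_lt with rfl | hlt
    · rw [hstart]; exact h.isActiveEquilibrium hin
    · exact (hpath r ⟨hlt, hr.2⟩).isActiveEquilibrium hσ
  have hnm' : ∀ r ∈ Ico σ.clock q, r < (1 - 1 / k) * M.mcost t (supply (path r) t) + 1 / k * l :=
    fun r hr => by
      have := hnm r hr t ht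
      unfold MeetsCriterion at this
      linarith
  have hcl : σ.clock < l := h.clock_lt
    (fun t ht => by have := hnm σ.clock ⟨le_rfl, hq⟩ t ht; rwa [hstart] at this) hk ht
  have hc0 : M.mcost t (supply σ.alloc t) ≤ σ.clock := h.active_price t ht ▸ h.mcost_le t
  -- Marginal costs only fall, so they stay below the initial clock. This keeps `q` below `l`, hence
  -- below every peak, where demand is continuous.
  have hbound : ∀ r ∈ Ico σ.clock q, r < (1 - 1 / k) * σ.clock + 1 / k * l := fun r hr => by
    have h1 := hnm' r hr
    have h2 : M.mcost t (supply (path r) t) ≤ σ.clock := by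
      rcases hr.1.eq_or_lt with rfl | hlt
      · rwa [hstart]
      · exact ((h.isActiveEquilibrium hin).mcost_le hσ (heq r ⟨hr.1, hr.2.le⟩) hlt t).trans hc0
    nlinarith
  have hql : q < l := by
    have : q ≤ (1 - 1 / k) * σ.clock + 1 / k * l := by
      by_contra! hlt
      have h1 := hbound (max σ.clock ((1 - 1 / k) * σ.clock + 1 / k * l))
        ⟨le_max_left _ _, max_lt hq hlt⟩
      exact h1.not_ge (le_max_right _ _)
    nlinarith
  refine ⟨hql, ?_⟩
  set c := M.mcost t (supply (path q) t) with hc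
  by_contra! hlt
  -- Half of the violation at `q`: by continuity the criterion would already be met slightly before
  -- `q`.
  set ε := (q - (c + 1 / k * (l - c))) / 2 with hε
  have hε0 : 0 < ε := by linarith
  obtain ⟨δ, hδ, H⟩ := (heq q ⟨hq.le, le_rfl⟩).mcost_continuous hM hσ
    (fun i => hql.trans_le (hl i)) t hε0
  set r := max σ.clock (q - min (δ / 2) (ε / 2)) with hr
  have hm : 0 < min (δ / 2) (ε / 2) := lt_min (by linarith) (by linarith)
  have hrq : r < q := max_lt hq (by linarith)
  have hr1 : q - min (δ / 2) (ε / 2) ≤ r := le_max_right _ _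
  have hmem : r ∈ Ico σ.clock q := ⟨le_max_left _ _, hrq⟩
  have h1 := (abs_lt.1 (H r (path r) (by
    rw [abs_sub_comm, abs_of_pos (by linarith)]
    linarith [min_le_left (δ / 2) (ε / 2)]) hrq.ne (heq r ⟨hmem.1, hrq.le⟩))).2
  have h2 := hnm' r hmem
  have h3 := min_le_right (δ / 2) (ε / 2)
  nlinarith

lemma raise (h : M.AscInv k l y σ) (hM : M.IsMHR) (hl : ∀ i, l ≤ M.lam i 0) (hk : 1 < k)
    {q : ℝ} {path : ℝ → B → S → ℝ} (hq : σ.clock < q)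
    (hinact : ∀ t, σ.itemStatus t = Status.inactive → q ≤ σ.price t)
    (hstart : path σ.clock = σ.alloc)
    (hpath : ∀ r ∈ Ioc σ.clock q, M.IsActiveMinCost σ r (path r))
    (hnm : ∀ r ∈ Ico σ.clock q, ∀ t, σ.itemStatus t = Status.active →
      ¬ MeetsCriterion k l r (M.mcost t (supply (path r) t)))
    {σ' : AscState B S} (hclock : σ'.clock = q)
    (hact : ∀ t, σ.itemStatus t = Status.active → σ'.price t = q)
    (hnact : ∀ t, σ.itemStatus t ≠ Status.active → σ'.price t = σ.price t)
    (halloc : σ'.alloc = path q) (hitem : σ'.itemStatus = σ.itemStatus)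
    (hbuyer : σ'.buyerStatus = σ.buyerStatus) : M.AscInv k l y σ' := by
  have hσ := h.alloc_nonneg
  have hin : ∀ t, σ.itemStatus t = Status.inactive → σ.clock < σ.price t :=
    fun t ht => hq.trans_le (hinact t ht)
  have hnm0 : ∀ t, σ.itemStatus t = Status.active →
      ¬ MeetsCriterion k l σ.clock (M.mcost t (supply σ.alloc t)) := fun t ht => by
    have := hnm σ.clock ⟨le_rfl, hq⟩ t ht
    rwa [hstart] at this
  have hE := h.isActiveEquilibrium hin
  have hE' : M.IsActiveEquilibrium σ q σ'.alloc :=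
    halloc ▸ (hpath q ⟨hq, le_rfl⟩).isActiveEquilibrium hσ
  have hz' := hE'.1.nonneg hσ
  have hupper : ∀ t, σ.itemStatus t = Status.active → q < l ∧
      q ≤ M.mcost t (supply σ'.alloc t) + 1 / k * (l - M.mcost t (supply σ'.alloc t)) :=
    fun t ht => halloc ▸ h.price_le_of_not_met hM hl hk hq hin hstart hpath hnm ht
  have hmc : ∀ t, M.mcost t (supply σ'.alloc t) ≤ M.mcost t (supply σ.alloc t) :=
    fun t => hE.mcost_le hσ hE' hq t
  have hsup : ∀ t, σ.itemStatus t ≠ Status.active → supply σ'.alloc t = supply σ.alloc t :=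
    fun t ht => hE'.1.supply_eq hE.1 ht
  have hmono : ∀ t, σ.price t ≤ σ'.price t := fun t => by
    by_cases ht : σ.itemStatus t = Status.active
    · rw [hact t ht, h.active_price t ht]; exact hq.le
    · rw [hnact t ht]
  have hfrozen : ∀ i, σ.buyerStatus i ≠ Status.active → ∀ t, 0 < σ.alloc i t →
      σ'.price t = σ.price t := fun i hi t ht => by
    refine hnact t ?_
    cases hs : σ.buyerStatus i with
    | inactive => rw [(h.inactive_buyer i hs).2 t ht]; simp
    | active => exact absurd hs hi
    | finished => rw [h.use_finished hin hnm0 hs ht]; simp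
  have hmin : ∀ i, σ.buyerStatus i = Status.active → M.minPrice σ'.price i = q := fun i hi => by
    refine le_antisymm ?_ (le_minPrice fun s hs => ?_)
    · obtain ⟨t, ht⟩ := exists_pos_of_demand_pos (h.active_demand i hi)
      rw [← hact t (h.use_active hin hi ht)]
      exact minPrice_le (h.envyFree.1.mem_items ht)
    · cases hst : σ.itemStatus s with
      | inactive => rw [hnact s (by simp [hst])]; exact hinact s hst
      | active => exact (hact s hst).ge
      | finished => exact absurd hst (h.not_finished hin hnm0 hk hi hs)
  have hmin' : ∀ i, σ.buyerStatus i ≠ Status.active → 0 < demand σ.alloc i →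
      M.minPrice σ'.price i = M.minPrice σ.price i := fun i hi hpos => by
    obtain ⟨t, ht⟩ := exists_pos_of_demand_pos hpos
    refine le_antisymm ?_ (le_minPrice fun s hs => (minPrice_le hs).trans (hmono s))
    rw [← h.envyFree.2.2 i t ht]
    simp only
    rw [← hfrozen i hi t ht]
    exact minPrice_le (h.envyFree.1.mem_items ht)
  constructor
  · refine ⟨⟨hz', fun i t ht => ?_, fun i => ?_⟩, fun i => ?_, fun i t ht => ?_⟩
    · by_cases hi : σ.buyerStatus i = Status.active
      · exact (hE'.1.2 i hi t).2 (Or.inl ht)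
      · simp only [hE'.1.1 i hi]; exact h.envyFree.1.2.1 i t ht
    · by_cases hi : σ.buyerStatus i = Status.active
      · exact (hE'.2.1 i hi).2.1
      · simp only [demand, hE'.1.1 i hi]; exact h.envyFree.1.2.2 i
    · by_cases hi : σ.buyerStatus i = Status.active
      · simp only [hmin i hi]; exact hE'.2.1 i hi
      · have hbr := h.envyFree.2.1 i
        have hd : demand σ'.alloc i = demand σ.alloc i := by simp only [demand, hE'.1.1 i hi]
        simp only [hd] at hbr ⊢
        -- A buyer with zero demand may see its cheapest price rise, and zero remains a best
        -- response; a frozen buyer with positive demand keeps its cheapest price.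
        rcases (demand_nonneg hσ i).eq_or_lt with h0 | hpos
        · rw [← h0] at hbr ⊢
          exact hbr.zero_of_le (le_minPrice fun s hs => (minPrice_le hs).trans (hmono s))
        · rw [hmin' i hi hpos]; exact hbr
    · simp only at ht ⊢
      by_cases hi : σ.buyerStatus i = Status.active
      · rw [hmin i hi, hact t (hE'.1.of_pos hi ht).2]
      · rw [hE'.1.1 i hi] at ht
        rw [hmin' i hi (ht.trans_le (le_demand hσ i t)), hfrozen i hi t ht]
        exact h.envyFree.2.2 i t ht
  · intro t ht
    rw [hitem] at ht
    rw [hact t ht, hclock]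
  · intro t ht
    rw [hitem] at ht
    rw [hnact t (by simp [ht]), hclock]
    exact ⟨hinact t ht, (h.inactive_price t ht).2⟩
  · intro t ht
    rw [hitem] at ht
    have hne : σ.itemStatus t ≠ Status.active := by simp [ht]
    rw [hnact t hne, hclock, hsup t hne]
    exact ⟨(h.finished_price t ht).1.trans hq.le, (h.finished_price t ht).2⟩
  · exact fun t => (h.start_le t).trans (hmono t)
  · intro t heq
    by_cases ht : σ.itemStatus t = Status.active
    · have h1 := h.start_le t
      rw [hact t ht] at heq
      rw [h.active_price t ht] at h1
      linarith
    · rw [hsup t ht]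
      exact h.supply_eq t (hnact t ht ▸ heq)
  · exact fun t => (hmc t).trans ((h.mcost_le t).trans (hmono t))
  · intro t
    by_cases ht : σ.itemStatus t = Status.active
    · rw [hact t ht]
      exact Or.inr (hupper t ht)
    · rw [hsup t ht, hnact t ht]
      exact h.price_le t
  · intro i hi
    rw [hbuyer] at hi
    rw [hitem, hE'.1.1 i (by simp [hi])]
    exact h.inactive_buyer i hi
  · intro i hi
    rw [hbuyer] at hi
    obtain ⟨t, ht⟩ := exists_pos_of_demand_pos (h.active_demand i hi)
    -- Active buyers keep a positive demand because the price is below every peak.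
    exact (hE'.2.1 i hi).pos ((hupper t (h.use_active hin hi ht)).1.trans_le (hl i))
  · intro i hi t ht
    rw [hbuyer] at hi
    have hta := (hE'.1.of_pos hi ht).2
    rw [hitem, hact t hta, hclock]
    simp [hta]
  · intro i hi t s ht hs hps
    rw [hbuyer] at hi
    cases hst : σ.itemStatus s with
    | active => exact hE'.2.2 i hi t s ht hs hst
    | finished => exact absurd hst (h.not_finished hin hnm0 hk hi hs)
    -- The price `q` of such an item is its marginal cost at its unchanged supply, and marginal
    -- costs of active items were at most the old clock.
    | inactive =>
      have hne : σ.itemStatus s ≠ Status.active := by simp [hst]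
      rw [hnact s hne, hclock] at hps
      have hs1 := (h.inactive_price s hst).2
      have hs2 := h.supply_eq s hs1
      rw [hsup s hne, hs2, ← hs1, hps]
      refine (hmc t).trans ((h.mcost_le t).trans ?_)
      rw [h.active_price t (hE'.1.of_pos hi ht).2]
      exact hq.le
  · intro i hi t ht
    rw [hbuyer] at hi
    rw [hE'.1.1 i (by simp [hi])] at ht
    rw [hitem]
    exact Or.inl (h.use_finished hin hnm0 hi ht)

open Classical in
lemma activate (h : M.AscInv k l y σ) (hy : M.IsWelfareOptimal y) {t : S}
    (ht : σ.itemStatus t = Status.inactive) (hp : σ.price t = σ.clock) :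
    M.AscInv k l y { σ with
      itemStatus := Function.update σ.itemStatus t Status.active
      buyerStatus := fun i =>
        if σ.buyerStatus i = Status.inactive ∧ 0 < σ.alloc i t then Status.active
        else σ.buyerStatus i } := by
  have hitem : ∀ r st, Function.update σ.itemStatus t Status.active r = st →
      (r = t ∧ st = Status.active) ∨ (r ≠ t ∧ σ.itemStatus r = st) := fun r st hr => by
    by_cases h1 : r = t
    · subst h1; rw [Function.update_self] at hr; exact Or.inl ⟨rfl, hr.symm⟩
    · rw [Function.update_of_ne h1] at hr; exact Or.inr ⟨h1, hr⟩
  have hnew : ∀ i, σ.buyerStatus i = Status.inactive → 0 < σ.alloc i t →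
      M.minPrice σ.price i = σ.clock := fun i _ hpos =>
    hp ▸ (h.envyFree.2.2 i t hpos).symm
  constructor
  · exact h.envyFree
  · intro r hr
    rcases hitem r _ hr with ⟨rfl, -⟩ | ⟨-, hr⟩
    · exact hp
    · exact h.active_price r hr
  · intro r hr
    rcases hitem r _ hr with ⟨rfl, h1⟩ | ⟨-, hr⟩
    · cases h1
    · exact h.inactive_price r hr
  · intro r hr
    rcases hitem r _ hr with ⟨rfl, h1⟩ | ⟨-, hr⟩
    · cases h1
    · exact h.finished_price r hr
  · exact h.start_le
  · exact h.supply_eq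
  · exact h.mcost_le
  · exact h.price_le
  · intro i hi
    simp only at hi ⊢
    split_ifs at hi with hc
    refine ⟨(h.inactive_buyer i hi).1, fun r hr => ?_⟩
    have hrt : r ≠ t := by rintro rfl; exact hc ⟨hi, hr⟩
    rw [Function.update_of_ne hrt]
    exact (h.inactive_buyer i hi).2 r hr
  · intro i hi
    simp only at hi ⊢
    split_ifs at hi with hc
    · exact hc.2.trans_le (le_demand h.alloc_nonneg i t)
    · exact h.active_demand i hi
  · intro i hi r hr
    simp only at hi hr ⊢
    split_ifs at hi with hc
    · refine ⟨fun hf => ?_, ?_⟩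
      · rcases hitem r _ hf with ⟨-, h1⟩ | ⟨-, h1⟩
        · cases h1
        · rw [(h.inactive_buyer i hc.1).2 r hr] at h1; cases h1
      · rw [← hnew i hc.1 hc.2]; exact h.envyFree.2.2 i r hr
    · refine ⟨fun hf => ?_, (h.active_use i hi r hr).2⟩
      rcases hitem r _ hf with ⟨-, h1⟩ | ⟨-, h1⟩
      · cases h1
      · exact (h.active_use i hi r hr).1 h1
  · intro i hi r s hr hs hps
    simp only at hi hr hps ⊢
    split_ifs at hi with hc
    -- The buyer still has its allocation from `y`. Optimality of `y` and `start_le` force the price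
    -- of `s` to be its initial one, so `supply_eq` transfers the comparison to the current state.
    · have hrin := (h.inactive_buyer i hc.1).2 r hr
      have hrp : σ.price r = σ.clock := by
        rw [← hnew i hc.1 hc.2]; exact h.envyFree.2.2 i r hr
      have hr1 := (h.inactive_price r hrin).2
      have hr' : 0 < y i r := by rwa [← (h.inactive_buyer i hc.1).1]
      have h1 := hy.mcost_le hr' hs
      have h2 := h.start_le s
      have h3 : σ.price s = M.mcost s (supply y s) := by linarith
      rw [h.supply_eq r hr1, h.supply_eq s h3]
      exact h1
    · exact h.active_mcost i hi r s hr hs hps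
  · intro i hi r hr
    simp only at hi hr ⊢
    split_ifs at hi with hc
    rcases h.finished_use i hi r hr with h1 | h1
    · left
      have hrt : r ≠ t := by rintro rfl; rw [ht] at h1; cases h1
      rw [Function.update_of_ne hrt, h1]
    · exact Or.inr h1

open Classical in
lemma finish (h : M.AscInv k l y σ) (hk : 1 < k) {t : S}
    (ht : σ.itemStatus t = Status.active)
    (hmet : MeetsCriterion k l (σ.price t) (M.mcost t (supply σ.alloc t))) :
    M.AscInv k l y { σ with
      itemStatus := Function.update σ.itemStatus t Status.finished
      buyerStatus := fun i =>
        if σ.buyerStatus i = Status.active ∧ 0 < σ.alloc i t then Status.finished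
        else σ.buyerStatus i } := by
  have hitem : ∀ r st, Function.update σ.itemStatus t Status.finished r = st →
      (r = t ∧ st = Status.finished) ∨ (r ≠ t ∧ σ.itemStatus r = st) := fun r st hr => by
    by_cases h1 : r = t
    · subst h1; rw [Function.update_self] at hr; exact Or.inl ⟨rfl, hr.symm⟩
    · rw [Function.update_of_ne h1] at hr; exact Or.inr ⟨h1, hr⟩
  constructor
  · exact h.envyFree
  · intro r hr
    rcases hitem r _ hr with ⟨rfl, h1⟩ | ⟨-, hr⟩
    · cases h1
    · exact h.active_price r hr
  · intro r hr
    rcases hitem r _ hr with ⟨rfl, h1⟩ | ⟨-, hr⟩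
    · cases h1
    · exact h.inactive_price r hr
  · intro r hr
    rcases hitem r _ hr with ⟨rfl, -⟩ | ⟨-, hr⟩
    · exact ⟨(h.active_price r ht).le, hmet⟩
    · exact h.finished_price r hr
  · exact h.start_le
  · exact h.supply_eq
  · exact h.mcost_le
  · exact h.price_le
  · intro i hi
    simp only at hi ⊢
    split_ifs at hi with hc
    refine ⟨(h.inactive_buyer i hi).1, fun r hr => ?_⟩
    have h1 := (h.inactive_buyer i hi).2 r hr
    have hrt : r ≠ t := by rintro rfl; rw [ht] at h1; cases h1
    rw [Function.update_of_ne hrt, h1]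
  · intro i hi
    simp only at hi ⊢
    split_ifs at hi with hc
    exact h.active_demand i hi
  · intro i hi r hr
    simp only at hi hr ⊢
    split_ifs at hi with hc
    have hrt : r ≠ t := by rintro rfl; exact hc ⟨hi, hr⟩
    rw [Function.update_of_ne hrt]
    exact h.active_use i hi r hr
  · intro i hi r s hr hs hps
    simp only at hi hr hps ⊢
    split_ifs at hi with hc
    exact h.active_mcost i hi r s hr hs hps
  · intro i hi r hr
    simp only at hi hr ⊢
    by_cases hrt : r = t
    · subst hrt; left; rw [Function.update_self]
    rw [Function.update_of_ne hrt]
    split_ifs at hi with hc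
    -- The other items of a newly frozen buyer have the same price as `t` and no larger marginal
    -- cost, so they meet the criterion as well.
    · have h1 := h.active_use i hc.1 r hr
      have h2 := h.active_price t ht
      refine Or.inr ⟨h1.2, ?_⟩
      rw [h1.2, ← h2]
      exact hmet.anti hk (h.active_mcost i hc.1 r t hr (h.envyFree.1.mem_items hc.2) h2)
    · exact h.finished_use i hi r hr

lemma step (h : M.AscInv k l y σ) (hM : M.IsMHR) (hl : ∀ i, l ≤ M.lam i 0) (hk : 1 < k)
    (hy : M.IsWelfareOptimal y) {σ' : AscState B S} (hs : M.AscStep k l σ σ') :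
    M.AscInv k l y σ' := by
  cases hs with
  | raise q path hq hinact hstart hpath hnm =>
    exact h.raise hM hl hk hq hinact hstart hpath hnm rfl (fun t ht => by simp [ht])
      (fun t ht => by simp [ht]) rfl rfl rfl
  | activate t ht hp => exact h.activate hy ht hp
  | finish t ht hmet => exact h.finish hk ht hmet

/-- Prices and marginal costs when all items are finished. -/
lemma price_eq (h : M.AscInv k l y σ) (hk : 1 < k) (hfin : ∀ t, σ.itemStatus t = Status.finished)
    (t : S) :
    M.mcost t (supply σ.alloc t) < l ∧ σ.price t =
        M.mcost t (supply σ.alloc t) + (l - M.mcost t (supply σ.alloc t)) / k ∨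
      l ≤ M.mcost t (supply σ.alloc t) ∧ σ.price t = M.mcost t (supply σ.alloc t) := by
  have h1 := (h.finished_price t (hfin t)).2
  have hk0 : 0 < 1 / k := by positivity
  unfold MeetsCriterion at h1
  rcases h.price_le t with h2 | ⟨h2, h3⟩
  · refine Or.inr ⟨?_, h2⟩
    rw [h2, sub_self] at h1
    by_contra! hlt
    exact h1.not_gt (mul_pos hk0 (by linarith))
  · exact Or.inl ⟨(h.mcost_le t).trans_lt h2, by
      rw [div_eq_mul_one_div, mul_comm (l - _)]; linarith⟩

end AscInv
end Market
end EnvyFreePricing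

namespace EnvyFreePricing
namespace Market

variable {B S : Type*} [Fintype B] [Fintype S] {M : Market B S}

/-! ### Existence of terminating runs -/

lemma isClosed_isActiveFlow (σ : AscState B S) : IsClosed {z | M.IsActiveFlow σ z} := by
  simp only [IsActiveFlow, ofPred_and, ofPred_forall]
  refine IsClosed.inter ?_ ?_
  · exact isClosed_iInter fun i => isClosed_iInter fun _ =>
      isClosed_eq (by fun_prop) continuous_const
  · exact isClosed_iInter fun i => isClosed_iInter fun _ => isClosed_iInter fun t =>
      (isClosed_le continuous_const (by fun_prop)).inter
        (isClosed_iInter fun _ => isClosed_eq (by fun_prop) continuous_const)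

/-- For a fixed choice of best responses the flows form a compact set, which is nonempty because
each active buyer can be served by a single active item. -/
lemma exists_isActiveMinCost {σ : AscState B S} (hσ : M.IsFeasible σ.alloc)
    (hacc : ∀ i, σ.buyerStatus i = Status.active →
      ∃ t ∈ M.items i, σ.itemStatus t = Status.active) (r : ℝ) :
    ∃ z, M.IsActiveMinCost σ r z := by
  classical
  choose x hx using fun i => M.exists_isBestResponse i r
  have hne : {z | M.IsActiveFlow σ z ∧
      ∀ i, σ.buyerStatus i = Status.active → demand z i = x i}.Nonempty := by
    have : ∀ i, ∃ t, σ.buyerStatus i = Status.active →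
        t ∈ M.items i ∧ σ.itemStatus t = Status.active := fun i => by
      by_cases hi : σ.buyerStatus i = Status.active
      · obtain ⟨t, ht⟩ := hacc i hi
        exact ⟨t, fun _ => ht⟩
      · obtain ⟨t, -⟩ := M.items_nonempty i
        exact ⟨t, fun h => absurd h hi⟩
    choose τ hτ using this
    refine ⟨fun i t => if σ.buyerStatus i = Status.active then (if t = τ i then x i else 0)
      else σ.alloc i t, ⟨fun i hi => by simp [hi], fun i hi t => ?_⟩, fun i hi => ?_⟩
    · beta_reduce
      rw [if_pos hi]
      refine ⟨?_, fun ht => if_neg ?_⟩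
      · split_ifs
        · exact (hx i).1
        · exact le_rfl
      · rintro rfl
        have := hτ i hi
        tauto
    · simp [demand, hi]
  have hclosed : IsClosed {z | M.IsActiveFlow σ z ∧
      ∀ i, σ.buyerStatus i = Status.active → demand z i = x i} := by
    have h2 : IsClosed {z : B → S → ℝ |
        ∀ i, σ.buyerStatus i = Status.active → demand z i = x i} := by
      simp only [ofPred_forall]
      exact isClosed_iInter fun i => isClosed_iInter fun _ =>
        isClosed_eq (continuous_demand i) continuous_const
    exact (isClosed_isActiveFlow σ).inter h2
  have hnn : ∀ z, M.IsActiveFlow σ z → ∀ i t, 0 ≤ z i t := fun z hz => hz.nonneg hσ.1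
  obtain ⟨z, ⟨hz1, hz2⟩, hz⟩ := M.exists_min_of_isClosed hclosed hne
    (fun z hz => ⟨hnn z hz.1, fun i => by
      by_cases hi : σ.buyerStatus i = Status.active
      · rw [hz.2 i hi]; exact (hx i).2.1
      · simp only [demand, hz.1.1 i hi]; exact hσ.2.2 i⟩)
    (M.continuousOn_totalCost.mono fun z hz => hnn z hz.1)
  refine ⟨z, hz1, fun i hi => (hz2 i hi).symm ▸ hx i, fun w hw hd => hz w ⟨hw, fun i hi => ?_⟩⟩
  rw [hd i, hz2 i hi]

namespace AscInv

variable {k l : ℝ} {y : B → S → ℝ} {σ : AscState B S}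

/-- The first price at which an active item meets the stopping criterion. -/
lemma exists_first_met (h : M.AscInv k l y σ) (hM : M.IsMHR) (hl : ∀ i, l ≤ M.lam i 0)
    (hk : 1 < k) (hin : ∀ t, σ.itemStatus t = Status.inactive → σ.clock < σ.price t)
    (hnm : ∀ t, σ.itemStatus t = Status.active →
      ¬ MeetsCriterion k l σ.clock (M.mcost t (supply σ.alloc t)))
    {path : ℝ → B → S → ℝ} (hstart : path σ.clock = σ.alloc)
    (hpath : ∀ r, σ.clock < r → M.IsActiveMinCost σ r (path r))
    {a : S} (ha : σ.itemStatus a = Status.active) :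
    ∃ q, σ.clock < q ∧
      (∃ t, σ.itemStatus t = Status.active ∧
        MeetsCriterion k l q (M.mcost t (supply (path q) t))) ∧
      ∀ r ∈ Ico σ.clock q, ∀ t, σ.itemStatus t = Status.active →
        ¬ MeetsCriterion k l r (M.mcost t (supply (path r) t)) := by
  have hσ := h.alloc_nonneg
  have hk1 : 1 / k < 1 := (div_lt_one (by linarith)).2 hk
  have hk0 : 0 < 1 / k := by positivity
  have hE := h.isActiveEquilibrium hin
  have heq : ∀ r, σ.clock ≤ r → M.IsActiveEquilibrium σ r (path r) := fun r hr => by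
    rcases hr.eq_or_lt with rfl | hlt
    · rwa [hstart]
    · exact (hpath r hlt).isActiveEquilibrium hσ
  have hcl : σ.clock < l := h.clock_lt hnm hk ha
  set T : Set ℝ := {r | σ.clock ≤ r ∧ r < l ∧ ∃ t, σ.itemStatus t = Status.active ∧
    MeetsCriterion k l r (M.mcost t (supply (path r) t))} with hT
  have hTne : T.Nonempty := by
    have h1 : σ.clock < (1 - 1 / k) * σ.clock + 1 / k * l := by nlinarith
    -- At this price any active item meets the criterion, since its marginal cost is at most the
    -- initial clock.
    refine ⟨(1 - 1 / k) * σ.clock + 1 / k * l, h1.le, by nlinarith, a, ha, ?_⟩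
    have h2 := hE.mcost_le hσ (heq _ h1.le) h1 a
    have h3 := h.mcost_le a
    rw [h.active_price a ha] at h3
    unfold MeetsCriterion
    nlinarith
  have hTb : BddBelow T := ⟨σ.clock, fun r hr => hr.1⟩
  set q := sInf T with hq
  have hcq : σ.clock ≤ q := le_csInf hTne fun r hr => hr.1
  have hql : q < l := by
    obtain ⟨r, hr⟩ := hTne
    exact (csInf_le hTb hr).trans_lt hr.2.1
  have hmet : ∃ t, σ.itemStatus t = Status.active ∧
      MeetsCriterion k l q (M.mcost t (supply (path q) t)) := by
    -- The infimum is attained: if no item met the criterion at `q`, continuity of marginal costs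
    -- would exclude an interval to the right of `q`.
    by_contra! hn
    have hex : ∀ t, ∃ δ > 0, σ.itemStatus t = Status.active → ∀ r, q < r → r < q + δ →
        ¬ MeetsCriterion k l r (M.mcost t (supply (path r) t)) := by
      intro t
      by_cases ht : σ.itemStatus t = Status.active
      · have h1 := hn t ht
        set c := M.mcost t (supply (path q) t) with hc
        unfold MeetsCriterion at h1
        push Not at h1
        set ε := (1 / k * (l - c) - (q - c)) / 2 with hε
        have hε0 : 0 < ε := by linarith
        obtain ⟨δ, hδ, H⟩ := (heq q hcq).mcost_continuous hM hσ
          (fun i => hql.trans_le (hl i)) t hε0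
        refine ⟨min δ ε, lt_min hδ hε0, fun _ r hqr hr hmet => ?_⟩
        have hr1 := hr.trans_le (add_le_add_right (min_le_left δ ε) q)
        have hr2 := hr.trans_le (add_le_add_right (min_le_right δ ε) q)
        have h2 := (abs_lt.1 (H r (path r) (by rw [abs_of_pos (by linarith)]; linarith) hqr.ne'
          (heq r (hcq.trans hqr.le)))).1
        unfold MeetsCriterion at hmet
        nlinarith
      · exact ⟨1, one_pos, fun h => absurd h ht⟩
    choose δ hδ hδ' using hex
    have : Nonempty S := ⟨a⟩
    obtain ⟨s, hs⟩ := Finite.exists_min δ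
    obtain ⟨r, hr, hrlt⟩ := exists_lt_of_csInf_lt hTne (show sInf T < q + δ s by
      linarith [hδ s])
    obtain ⟨t, ht, hmt⟩ := hr.2.2
    rcases (csInf_le hTb hr).eq_or_lt with heq' | hlt
    · refine hn t ht ?_
      rw [hq, heq']
      exact hmt
    · exact hδ' t ht r hlt (hrlt.trans_le (add_le_add_right (hs t) q)) hmt
  refine ⟨q, hcq.lt_of_ne fun he => ?_, hmet, fun r hr t ht hmt => ?_⟩
  · obtain ⟨t, ht, hmt⟩ := hmet
    rw [← he, hstart] at hmt
    exact hnm t ht hmt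
  · exact (csInf_le hTb ⟨hr.1, hr.2.trans hql, t, ht, hmt⟩).not_gt hr.2

/-- When nothing is pending, the price can be raised until some event is pending. -/
lemma exists_raise (h : M.AscInv k l y σ) (hM : M.IsMHR) (hl : ∀ i, l ≤ M.lam i 0)
    (hk : 1 < k) (hin : ∀ t, σ.itemStatus t = Status.inactive → σ.clock < σ.price t)
    (hnm : ∀ t, σ.itemStatus t = Status.active →
      ¬ MeetsCriterion k l σ.clock (M.mcost t (supply σ.alloc t)))
    (hnf : ∃ t, σ.itemStatus t ≠ Status.finished) :
    ∃ σ', M.AscStep k l σ σ' ∧ σ'.itemStatus = σ.itemStatus ∧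
      ((∃ t, σ'.itemStatus t = Status.inactive ∧ σ'.price t = σ'.clock) ∨
        ∃ t, σ'.itemStatus t = Status.active ∧
          MeetsCriterion k l (σ'.price t) (M.mcost t (supply σ'.alloc t))) := by
  classical
  have hacc : ∀ i, σ.buyerStatus i = Status.active →
      ∃ t ∈ M.items i, σ.itemStatus t = Status.active := fun i hi => by
    obtain ⟨t, ht⟩ := exists_pos_of_demand_pos (h.active_demand i hi)
    exact ⟨t, h.envyFree.1.mem_items ht, h.use_active hin hi ht⟩
  choose flow hflow using exists_isActiveMinCost h.envyFree.1 hacc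
  set path : ℝ → B → S → ℝ := fun r => if r = σ.clock then σ.alloc else flow r with hpathdef
  have hstart : path σ.clock = σ.alloc := by simp [hpathdef]
  have hpath : ∀ r, σ.clock < r → M.IsActiveMinCost σ r (path r) := fun r hr => by
    simp only [hpathdef, if_neg hr.ne']
    exact hflow r
  have hmin : ∀ t, σ.itemStatus t = Status.inactive → ∃ s, σ.itemStatus s = Status.inactive ∧
      σ.price s ≤ σ.price t ∧ ∀ r, σ.itemStatus r = Status.inactive → σ.price s ≤ σ.price r := by
    intro t ht
    obtain ⟨s, hs, hle⟩ := Finset.exists_min_image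
      (Finset.univ.filter fun t => σ.itemStatus t = Status.inactive) σ.price ⟨t, by simp [ht]⟩
    simp only [Finset.mem_filter, Finset.mem_univ, true_and] at hs hle
    exact ⟨s, hs, hle t ht, hle⟩
  -- Either the lowest inactive price can be reached before the criterion is met, or the price is
  -- raised to the first point at which it is met.
  by_cases hfirst : ∃ s, σ.itemStatus s = Status.inactive ∧
      (∀ r, σ.itemStatus r = Status.inactive → σ.price s ≤ σ.price r) ∧
      ∀ r ∈ Ico σ.clock (σ.price s), ∀ t, σ.itemStatus t = Status.active →
        ¬ MeetsCriterion k l r (M.mcost t (supply (path r) t))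
  · obtain ⟨s, hs, hle, hnms⟩ := hfirst
    exact ⟨_, AscStep.raise σ (σ.price s) path (hin s hs) hle hstart
      (fun r hr => hpath r hr.1) hnms, rfl, Or.inl ⟨s, hs, by simp [hs]⟩⟩
  · push Not at hfirst
    obtain ⟨a, ha⟩ : ∃ a, σ.itemStatus a = Status.active := by
      obtain ⟨t, ht⟩ := hnf
      cases hst : σ.itemStatus t with
      | finished => exact absurd hst ht
      | active => exact ⟨t, hst⟩
      | inactive =>
        obtain ⟨s, hs, -, hle⟩ := hmin t hst
        obtain ⟨-, -, a, ha, -⟩ := hfirst s hs hle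
        exact ⟨a, ha⟩
    obtain ⟨q, hq, ⟨t, ht, hmt⟩, hnmq⟩ :=
      h.exists_first_met hM hl hk hin hnm hstart hpath ha
    refine ⟨_, AscStep.raise σ q path hq (fun s hs => ?_) hstart
      (fun r hr => hpath r hr.1) hnmq, rfl, Or.inr ⟨t, ht, by simpa [ht] using hmt⟩⟩
    by_contra! hlt
    obtain ⟨s', hs', hle', hle⟩ := hmin s hs
    obtain ⟨r, hr, b, hb, hmb⟩ := hfirst s' hs' hle
    exact hnmq r ⟨hr.1, hr.2.trans_le (hle'.trans hlt.le)⟩ b hb hmb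

/-- Number of events that are still to come for an item. -/
def _root_.EnvyFreePricing.Status.rank : Status → ℕ
  | .inactive => 2
  | .active => 1
  | .finished => 0

open Classical in
lemma sum_rank_update_lt {f : S → Status} {t : S} {st : Status} (h : st.rank < (f t).rank) :
    ∑ r, (Function.update f t st r).rank < ∑ r, (f r).rank := by
  refine Finset.sum_lt_sum (fun r _ => ?_) ⟨t, Finset.mem_univ t, by rwa [Function.update_self]⟩
  by_cases hr : r = t
  · subst hr; rw [Function.update_self]; exact h.le
  · rw [Function.update_of_ne hr]

lemma exists_event (h : (∃ t, σ.itemStatus t = Status.inactive ∧ σ.price t = σ.clock) ∨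
      ∃ t, σ.itemStatus t = Status.active ∧
        MeetsCriterion k l (σ.price t) (M.mcost t (supply σ.alloc t))) :
    ∃ σ', M.AscStep k l σ σ' ∧ ∑ t, (σ'.itemStatus t).rank < ∑ t, (σ.itemStatus t).rank := by
  rcases h with ⟨t, ht, hp⟩ | ⟨t, ht, hm⟩
  · exact ⟨_, AscStep.activate σ t ht hp, sum_rank_update_lt (by simp [ht, Status.rank])⟩
  · exact ⟨_, AscStep.finish σ t ht hm, sum_rank_update_lt (by simp [ht, Status.rank])⟩

/-- Strong induction on the total rank: a rise, if needed, leaves the rank unchanged and makes an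
event possible, which lowers it. -/
lemma exists_run (hM : M.IsMHR) (hl : ∀ i, l ≤ M.lam i 0) (hk : 1 < k)
    (hy : M.IsWelfareOptimal y) (n : ℕ) : ∀ σ : AscState B S, M.AscInv k l y σ →
      ∑ t, (σ.itemStatus t).rank = n → ∃ σ', Relation.ReflTransGen (M.AscStep k l) σ σ' ∧
        ∀ t, σ'.itemStatus t = Status.finished := by
  induction n using Nat.strong_induction_on with
  | _ n ih =>
    intro σ h hn
    by_cases hnf : ∃ t, σ.itemStatus t ≠ Status.finished
    swap
    · push Not at hnf
      exact ⟨σ, .refl, hnf⟩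
    obtain ⟨σ₁, hσ₁, h₁, hrank, hev⟩ : ∃ σ₁, Relation.ReflTransGen (M.AscStep k l) σ σ₁ ∧
        M.AscInv k l y σ₁ ∧ σ₁.itemStatus = σ.itemStatus ∧
        ((∃ t, σ₁.itemStatus t = Status.inactive ∧ σ₁.price t = σ₁.clock) ∨
        ∃ t, σ₁.itemStatus t = Status.active ∧
          MeetsCriterion k l (σ₁.price t) (M.mcost t (supply σ₁.alloc t))) := by
      by_cases hev : (∃ t, σ.itemStatus t = Status.inactive ∧ σ.price t = σ.clock) ∨
        ∃ t, σ.itemStatus t = Status.active ∧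
          MeetsCriterion k l (σ.price t) (M.mcost t (supply σ.alloc t))
      · exact ⟨σ, .refl, h, rfl, hev⟩
      · push Not at hev
        obtain ⟨σ₁, hs, hi, hev'⟩ := h.exists_raise hM hl hk
          (fun t ht => (h.inactive_price t ht).1.lt_of_ne (hev.1 t ht).symm)
          (fun t ht => h.active_price t ht ▸ hev.2 t ht) hnf
        exact ⟨σ₁, .single hs, h.step hM hl hk hy hs, hi, hev'⟩
    obtain ⟨σ₂, hs₂, hlt⟩ := exists_event hev
    rw [hrank, hn] at hlt
    obtain ⟨σ₃, hσ₃, hfin⟩ := ih _ hlt σ₂ (h₁.step hM hl hk hy hs₂) rfl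
    exact ⟨σ₃, (hσ₁.tail hs₂).trans hσ₃, hfin⟩

lemma run (h : M.AscInv k l y σ) (hM : M.IsMHR) (hl : ∀ i, l ≤ M.lam i 0) (hk : 1 < k)
    (hy : M.IsWelfareOptimal y) {σ' : AscState B S}
    (hs : Relation.ReflTransGen (M.AscStep k l) σ σ') : M.AscInv k l y σ' := by
  induction hs with
  | refl => exact h
  | tail _ hs ih => exact ih.step hM hl hk hy hs

end AscInv

variable {k l : ℝ}

lemma exists_ascReturns [Nonempty S] (hM : M.IsMHR) (hl : ∀ i, l ≤ M.lam i 0) (hk : 1 < k) :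
    ∃ s, M.AscReturns k l s := by
  obtain ⟨y, hy⟩ := M.exists_isWelfareOptimal
  obtain ⟨σ, hσ, hfin⟩ := AscInv.exists_run hM hl hk hy _ _ (AscInv.init (k := k) (l := l) hy) rfl
  exact ⟨_, y, σ, hy, hσ, hfin, rfl⟩

/-- Solutions returned by the ascending-price procedure. -/
lemma AscReturns.spec [Nonempty S] (hM : M.IsMHR) (hl : ∀ i, l ≤ M.lam i 0) (hk : 1 < k)
    {s : Solution B S} (h : M.AscReturns k l s) :
    M.IsEnvyFree s ∧ ∀ t,
      (M.mcost t (supply s.alloc t) < l ∧ s.price t =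
        M.mcost t (supply s.alloc t) + (l - M.mcost t (supply s.alloc t)) / k ∨
      l ≤ M.mcost t (supply s.alloc t) ∧ s.price t = M.mcost t (supply s.alloc t)) := by
  obtain ⟨y, σ, hy, hσ, hfin, rfl⟩ := h
  have hinv : M.AscInv k l y σ := (AscInv.init hy).run hM hl hk hy hσ
  exact ⟨hinv.envyFree, hinv.price_eq hk hfin⟩

end Market
end EnvyFreePricing

namespace EnvyFreePricing
namespace Market

variable {B S : Type*} [Fintype B] [Fintype S] {M : Market B S}

/-! ### Payments, revenue and welfare -/

lemma sum_mul_supply (p : S → ℝ) (z : B → S → ℝ) :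
    ∑ t, p t * supply z t = ∑ i, ∑ t, p t * z i t := by
  simp only [supply, Finset.mul_sum]
  exact Finset.sum_comm

lemma IsEnvyFree.payment_eq {s : Solution B S} (h : M.IsEnvyFree s) :
    ∑ t, s.price t * supply s.alloc t = ∑ i, M.minPrice s.price i * demand s.alloc i := by
  rw [sum_mul_supply]
  refine Finset.sum_congr rfl fun i _ => ?_
  rw [demand, Finset.mul_sum]
  refine Finset.sum_congr rfl fun t _ => ?_
  rcases (h.1.1 i t).eq_or_lt with h0 | h0
  · rw [← h0]; simp
  · rw [h.2.2 i t h0]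

lemma revenue_eq (s : Solution B S) :
    M.revenue s = ∑ t, s.price t * supply s.alloc t - M.totalCost s.alloc := by
  simp only [revenue, totalCost, Finset.sum_sub_distrib]

lemma IsEnvyFree.revenue_le_welfare {s : Solution B S} (h : M.IsEnvyFree s) :
    M.revenue s ≤ M.welfare s.alloc := by
  rw [revenue_eq, welfare, h.payment_eq]
  refine sub_le_sub_right (Finset.sum_le_sum fun i _ => ?_) _
  have hb := h.2.1 i
  have := M.le_integral_lam i le_rfl hb.1 hb.2.1
    fun z hz => hb.2.2.1 z (Ioo_subset_Ico_self hz)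
  rwa [sub_zero] at this

/-- The price is a supergradient at `x` of the concave gross value. -/
lemma IsBestResponse.integral_le {i : B} {p x u : ℝ} (h : M.IsBestResponse i p x) (hu : 0 ≤ u)
    (huT : u ≤ M.pop i) :
    (∫ z in (0 : ℝ)..u, M.lam i z) - ∫ z in (0 : ℝ)..x, M.lam i z ≤ p * (u - x) := by
  rw [M.integral_lam_sub i h.1 h.2.1 hu huT]
  rcases le_total x u with hxu | hxu
  · exact M.integral_lam_le i h.1 hxu huT fun z hz => h.2.2.2 z ⟨hz.1, hz.2.trans_le huT⟩
  · have := M.le_integral_lam i hu hxu h.2.1 fun z hz => h.2.2.1 z ⟨hu.trans hz.1.le, hz.2⟩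
    rw [intervalIntegral.integral_symm]
    linarith

lemma totalCost_mono (hD : M.IsDoublyConvex) {w z : B → S → ℝ} (hw : ∀ i t, 0 ≤ w i t)
    (h : ∀ i t, w i t ≤ z i t) : M.totalCost w ≤ M.totalCost z :=
  Finset.sum_le_sum fun t _ =>
    hD.cost_mono t (supply_nonneg hw t) (Finset.sum_le_sum fun i _ => h i t)

lemma totalCost_nonneg (hD : M.IsDoublyConvex) {w : B → S → ℝ} (hw : ∀ i t, 0 ≤ w i t) :
    0 ≤ M.totalCost w :=
  Finset.sum_nonneg fun t _ => hD.cost_nonneg t (supply_nonneg hw t)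

/-! ### Welfare of the ascending-price solution -/

/-- The relation between prices and marginal costs at the end of the ascending-price procedure. -/
def IsCriterionPriced (M : Market B S) (l : ℝ) (s : Solution B S) : Prop :=
  ∀ t, (M.mcost t (supply s.alloc t) < l ∧ s.price t =
        M.mcost t (supply s.alloc t) + (l - M.mcost t (supply s.alloc t)) / Real.exp 1 ∨
      l ≤ M.mcost t (supply s.alloc t) ∧ s.price t = M.mcost t (supply s.alloc t))

section Criterion

variable {l : ℝ} {s : Solution B S}

lemma exp_one_gt : (2.718 : ℝ) < Real.exp 1 := by linarith [Real.exp_one_gt_d9]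

lemma exp_one_lt : Real.exp 1 < (2.7183 : ℝ) := by linarith [Real.exp_one_lt_d9]

lemma IsCriterionPriced.mcost_le (h : M.IsCriterionPriced l s) (t : S) :
    M.mcost t (supply s.alloc t) ≤ s.price t := by
  rcases h t with ⟨h1, h2⟩ | ⟨h1, h2⟩
  · have : 0 ≤ (l - M.mcost t (supply s.alloc t)) / Real.exp 1 :=
      div_nonneg (by linarith) (Real.exp_pos 1).le
    linarith
  · exact h2.ge

lemma IsCriterionPriced.le_price (h : M.IsCriterionPriced l s)
    (hD : M.IsDoublyConvex) (hs : ∀ i t, 0 ≤ s.alloc i t) (t : S) :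
    l ≤ Real.exp 1 * s.price t := by
  have hc := hD.mcost_nonneg t (supply_nonneg hs t)
  have he := exp_one_gt
  rcases h t with ⟨h1, h2⟩ | ⟨h1, h2⟩
  · rw [h2, mul_add, mul_div_cancel₀ _ (Real.exp_pos 1).ne']
    nlinarith
  · rw [h2]; nlinarith

/-- The price is `max c ((1 - 1 / e) * c + l / e)`, which is strictly increasing in `c`. -/
lemma IsCriterionPriced.mcost_le_of_price_le (h : M.IsCriterionPriced l s) {t r : S}
    (htr : s.price t ≤ s.price r) :
    M.mcost t (supply s.alloc t) ≤ M.mcost r (supply s.alloc r) := by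
  have he := exp_one_gt
  have hx : 0 < 1 / Real.exp 1 := by positivity
  have hx1 : 1 / Real.exp 1 < 1 := (div_lt_one (Real.exp_pos 1)).2 (by linarith)
  rcases h t with ⟨h1, h2⟩ | ⟨h1, h2⟩ <;> rcases h r with ⟨h3, h4⟩ | ⟨h3, h4⟩ <;>
    try simp only [div_eq_mul_one_div (_ - _)] at h2 h4
  all_goals nlinarith

/-- The ascending-price solution has at least a fraction `1 - 1 / e` of the optimal welfare. -/
lemma IsCriterionPriced.welfare_ge (h : M.IsCriterionPriced l s) (hM : M.IsMHR)
    (hD : M.IsDoublyConvex) (hs : M.IsEnvyFree s) (hl : ∀ i, l ≤ M.lam i 0) {z : B → S → ℝ}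
    (hz : M.IsFeasible z) :
    (Real.exp 1 - 1) * M.welfare z ≤ Real.exp 1 * M.welfare s.alloc := by
  have he := exp_one_gt
  set c : S → ℝ := fun t => M.mcost t (supply s.alloc t) with hc
  -- A cheapest item of each buyer also has least marginal cost, so it values the demand of `s`
  -- exactly and that of `z` from below.
  choose τ hτ hτp using fun i => exists_minPrice (M := M) s.price i
  have hmin : ∀ i, ∀ t ∈ M.items i, c (τ i) ≤ c t := fun i t ht =>
    h.mcost_le_of_price_le ((hτp i).symm.trans_le (minPrice_le ht))
  have huse : ∀ i t, 0 < s.alloc i t → c t = c (τ i) := fun i t ht =>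
    le_antisymm (h.mcost_le_of_price_le ((hs.2.2 i t ht).trans (hτp i)).le)
      (hmin i t (hs.1.mem_items ht))
  have hy : ∑ t, c t * supply s.alloc t = ∑ i, c (τ i) * demand s.alloc i := by
    rw [sum_mul_supply]
    refine Finset.sum_congr rfl fun i _ => ?_
    rw [demand, Finset.mul_sum]
    refine Finset.sum_congr rfl fun t _ => ?_
    rcases (hs.1.1 i t).eq_or_lt with h0 | h0
    · rw [← h0]; simp
    · rw [huse i t h0]
  have hzc : ∑ i, c (τ i) * demand z i ≤ ∑ t, c t * supply z t := by
    rw [sum_mul_supply]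
    refine Finset.sum_le_sum fun i _ => ?_
    rw [demand, Finset.mul_sum]
    refine Finset.sum_le_sum fun t _ => ?_
    rcases (hz.1 i t).eq_or_lt with h0 | h0
    · rw [← h0]; simp
    · exact mul_le_mul_of_nonneg_right (hmin i t (hz.mem_items h0)) h0.le
  have hcost1 : M.totalCost s.alloc + ∑ t, c t * supply z t - ∑ t, c t * supply s.alloc t ≤
      M.totalCost z := by
    rw [totalCost, totalCost, ← Finset.sum_add_distrib, ← Finset.sum_sub_distrib]
    refine Finset.sum_le_sum fun t _ => ?_
    have := M.cost_support t (supply_nonneg hz.1 t) (supply_nonneg hs.1.1 t)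
    simp only [hc]
    linarith
  have hcost2 : M.totalCost s.alloc ≤ ∑ t, c t * supply s.alloc t := by
    refine Finset.sum_le_sum fun t _ => ?_
    have := M.cost_support t le_rfl (supply_nonneg hs.1.1 t)
    rw [M.cost_zero] at this
    simp only [hc]
    linarith
  have hloss : ∀ i, (Real.exp 1 - 1) * ((∫ x in (0 : ℝ)..demand z i, M.lam i x) -
      (∫ x in (0 : ℝ)..demand s.alloc i, M.lam i x) -
        c (τ i) * (demand z i - demand s.alloc i)) ≤
      (∫ x in (0 : ℝ)..demand s.alloc i, M.lam i x) - c (τ i) * demand s.alloc i := by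
    intro i
    have hb := hs.2.1 i
    rw [M.integral_lam_sub i hb.1 hb.2.1 (demand_nonneg hz.1 i) (hz.2.2 i)]
    refine hM.surplus_loss_le (hD.mcost_nonneg _ (supply_nonneg hs.1.1 _)) hb
      ⟨demand_nonneg hz.1 i, hz.2.2 i⟩ (hl i) ?_
    rw [hτp i]
    exact (h (τ i)).imp_right And.right
  have hsum := Finset.sum_le_sum fun i (_ : i ∈ Finset.univ) => hloss i
  rw [← Finset.mul_sum] at hsum
  simp only [mul_sub, Finset.sum_sub_distrib] at hsum
  simp only [welfare]
  nlinarith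

end Criterion

/-! ### Candidates -/

lemma minPrice_max (p : S → ℝ) (m : ℝ) (i : B) :
    M.minPrice (fun t => max (p t) m) i = max (M.minPrice p i) m := by
  obtain ⟨t, ht, hp⟩ := exists_minPrice (M := M) p i
  refine le_antisymm ?_ (le_minPrice fun s hs => max_le_max_right m (minPrice_le hs))
  rw [hp]
  exact minPrice_le (p := fun t => max (p t) m) ht

/-- Scale the rows of the allocation `y` to the demand `x`. -/
def scaled (y : B → S → ℝ) (x : B → ℝ) : B → S → ℝ := fun i t => x i / demand y i * y i t

section Scaled

variable {y : B → S → ℝ} {x : B → ℝ} (hy : ∀ i t, 0 ≤ y i t)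
  (hx : ∀ i, 0 ≤ x i) (hxy : ∀ i, x i ≤ demand y i)

include hy hx

lemma scaled_nonneg (i : B) (t : S) : 0 ≤ scaled y x i t :=
  mul_nonneg (div_nonneg (hx i) (demand_nonneg hy i)) (hy i t)

include hxy

lemma scaled_le (i : B) (t : S) : scaled y x i t ≤ y i t :=
  mul_le_of_le_one_left (hy i t) (div_le_one_of_le₀ (hxy i) (demand_nonneg hy i))

lemma demand_scaled (i : B) : demand (scaled y x) i = x i := by
  have : demand (scaled y x) i = x i / demand y i * demand y i := by
    simp only [demand, scaled, Finset.mul_sum]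
  rw [this]
  rcases (demand_nonneg hy i).eq_or_lt with h0 | h0
  · have := hxy i
    rw [← h0] at this ⊢
    rw [mul_zero]
    exact le_antisymm (hx i) this
  · exact div_mul_cancel₀ _ h0.ne'

end Scaled

/-- A common price floor keeps cheapest items cheapest, so the scaled rows still use only such
items. -/
lemma IsEnvyFree.scaled {s : Solution B S} (h : M.IsEnvyFree s) {p : S → ℝ} {m : ℝ}
    (hp : ∀ t, p t = max (s.price t) m) {x : B → ℝ}
    (hx : ∀ i, M.IsBestResponse i (M.minPrice p i) (x i)) (hxs : ∀ i, x i ≤ demand s.alloc i) :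
    M.IsEnvyFree ⟨p, Market.scaled s.alloc x⟩ := by
  have hd := demand_scaled h.1.1 (fun i => (hx i).1) hxs
  have hle := scaled_le h.1.1 (fun i => (hx i).1) hxs
  have hnn := scaled_nonneg h.1.1 (fun i => (hx i).1)
  refine ⟨⟨hnn, fun i t ht => ?_, fun i => ?_⟩, fun i => ?_, fun i t ht => ?_⟩
  · exact le_antisymm ((hle i t).trans_eq (h.1.2.1 i t ht)) (hnn i t)
  · rw [hd]; exact (hx i).2.1
  · rw [hd]; exact hx i
  · obtain rfl : p = fun t => max (s.price t) m := funext hp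
    rw [minPrice_max, ← h.2.2 i t (lt_of_lt_of_le ht (hle i t))]

lemma exists_isCandidate {s₀ : Solution B S} (h : M.IsEnvyFree s₀) (j : ℕ) :
    ∃ s, M.IsCandidate s₀ j s := by
  set m := Real.exp ((j : ℝ) - 1) * M.minPeak
  set p : S → ℝ := fun t => max (s₀.price t) m with hp
  choose b hb using fun i => M.exists_isBestResponse i (M.minPrice p i)
  set x : B → ℝ := fun i => min (b i) (demand s₀.alloc i)
  have hx : ∀ i, M.IsBestResponse i (M.minPrice p i) (x i) := fun i =>
    (h.2.1 i).inf (hb i) (by rw [hp, minPrice_max]; exact le_max_left _ _)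
  have hxs : ∀ i, x i ≤ demand s₀.alloc i := fun i => min_le_right _ _
  have hclosed : IsClosed {z : B → S → ℝ | M.IsFeasible z ∧ (∀ i, demand z i = x i) ∧
      ∀ i t, p t ≠ M.minPrice p i → z i t = 0} := by
    have h2 : IsClosed {z : B → S → ℝ | ∀ i, demand z i = x i} := by
      simp only [ofPred_forall]
      exact isClosed_iInter fun i => isClosed_eq (continuous_demand i) continuous_const
    have h3 : IsClosed {z : B → S → ℝ | ∀ i t, p t ≠ M.minPrice p i → z i t = 0} := by
      simp only [ofPred_forall]
      exact isClosed_iInter fun i => isClosed_iInter fun t => isClosed_iInter fun _ =>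
        isClosed_eq (by fun_prop) continuous_const
    exact M.isClosed_isFeasible.inter (h2.inter h3)
  have hmem : ∀ z, M.IsEnvyFree ⟨p, z⟩ → (∀ i, demand z i = x i) →
      M.IsFeasible z ∧ (∀ i, demand z i = x i) ∧ ∀ i t, p t ≠ M.minPrice p i → z i t = 0 := by
    refine fun z hz hd => ⟨hz.1, hd, fun i t hne => ?_⟩
    by_contra h0
    exact hne (hz.2.2 i t ((hz.1.1 i t).lt_of_ne (Ne.symm h0)))
  obtain ⟨z, ⟨hz1, hz2, hz3⟩, hz⟩ := M.exists_min_of_isClosed hclosed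
    ⟨_, hmem _ (h.scaled (fun _ => rfl) hx hxs)
      (demand_scaled h.1.1 (fun i => (hx i).1) hxs)⟩
    (fun z hz => ⟨hz.1.1, hz.1.2.2⟩) (M.continuousOn_totalCost.mono fun z hz => hz.1.1)
  refine ⟨⟨p, z⟩, fun _ => rfl, ⟨hz1, fun i => ?_, fun i t ht => ?_⟩, fun i => ?_, fun w hw hd => ?_⟩
  · simp only [hz2]; exact hx i
  · by_contra hne
    exact ht.ne' (hz3 i t hne)
  · simp only [hz2]; exact hxs i
  · exact hz w (hmem w hw fun i => (hd i).trans (hz2 i))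

section Candidate

variable {s₀ s : Solution B S} {j : ℕ} {l : ℝ}

lemma two_mul_totalCost_le (hD : M.IsDoublyConvex) (h₀ : M.IsEnvyFree s₀)
    (hp : M.IsCriterionPriced l s₀) {p : S → ℝ} (hpp : ∀ t, s₀.price t ≤ p t) {w : B → S → ℝ}
    (hw : ∀ i t, 0 ≤ w i t) (hws : ∀ i t, w i t ≤ s₀.alloc i t) :
    2 * M.totalCost w ≤ ∑ t, p t * supply w t := by
  rw [totalCost, Finset.mul_sum]
  refine Finset.sum_le_sum fun t _ => (hD.two_mul_cost_le t (supply_nonneg hw t)).trans ?_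
  refine mul_le_mul_of_nonneg_right ?_ (supply_nonneg hw t)
  exact (M.mcost_monotoneOn t (supply_nonneg hw t) (supply_nonneg h₀.1.1 t)
    (Finset.sum_le_sum fun i _ => hws i t)).trans ((hp.mcost_le t).trans (hpp t))

lemma IsCriterionPriced.payment_le (hp : M.IsCriterionPriced l s₀) (hD : M.IsDoublyConvex)
    (h₀ : M.IsEnvyFree s₀) : ∑ t, s₀.price t * supply s₀.alloc t ≤ 2 * M.revenue s₀ := by
  have := two_mul_totalCost_le hD h₀ hp (fun _ => le_rfl) h₀.1.1 (fun _ _ => le_rfl)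
  rw [revenue_eq]
  linarith

lemma IsCandidate.totalCost_le_scaled (h : M.IsCandidate s₀ j s) (h₀ : M.IsEnvyFree s₀) :
    M.totalCost s.alloc ≤ M.totalCost (Market.scaled s₀.alloc (demand s.alloc)) := by
  have hef := h₀.scaled h.1 h.2.1.2.1 h.2.2.1
  exact h.2.2.2 _ hef fun i => demand_scaled h₀.1.1 (demand_nonneg h.2.1.1.1) h.2.2.1 i

lemma IsCandidate.totalCost_le (h : M.IsCandidate s₀ j s) (hD : M.IsDoublyConvex)
    (h₀ : M.IsEnvyFree s₀) : M.totalCost s.alloc ≤ M.totalCost s₀.alloc := by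
  have hnn := demand_nonneg h.2.1.1.1
  exact (h.totalCost_le_scaled h₀).trans (totalCost_mono hD
    (scaled_nonneg h₀.1.1 hnn) (scaled_le h₀.1.1 hnn h.2.2.1))

/-- Payments depend only on cheapest prices and demand, so the candidate and the scaled allocation
collect the same. The scaled one has supplies below those of `s₀`, hence marginal costs below
prices, and the candidate costs no more. -/
lemma IsCandidate.payment_le (h : M.IsCandidate s₀ j s) (hD : M.IsDoublyConvex)
    (h₀ : M.IsEnvyFree s₀) (hp : M.IsCriterionPriced l s₀) :
    ∑ t, s.price t * supply s.alloc t ≤ 2 * M.revenue s := by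
  have hnn := demand_nonneg h.2.1.1.1
  have h1 := two_mul_totalCost_le hD h₀ hp (p := s.price)
    (fun t => by rw [h.1]; exact le_max_left _ _)
    (scaled_nonneg h₀.1.1 hnn) (scaled_le h₀.1.1 hnn h.2.2.1)
  have hef := h₀.scaled h.1 h.2.1.2.1 h.2.2.1
  have h2 := hef.payment_eq
  simp only [demand_scaled h₀.1.1 hnn h.2.2.1] at h2
  rw [h2, ← h.2.1.payment_eq] at h1
  have h3 := h.totalCost_le_scaled h₀
  rw [revenue_eq]
  linarith

lemma IsCandidate.minPrice_eq (h : M.IsCandidate s₀ j s) (i : B) :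
    M.minPrice s.price i = max (M.minPrice s₀.price i) (Real.exp ((j : ℝ) - 1) * M.minPeak) := by
  rw [show s.price = fun t => max (s₀.price t) (Real.exp ((j : ℝ) - 1) * M.minPeak) from
    funext h.1, minPrice_max]

end Candidate

/-! ### Peaks -/

section Peaks

variable [Nonempty B]

lemma minPeak_le (i : B) : M.minPeak ≤ M.lam i 0 := ciInf_le (Finite.bddBelow_range _) i

lemma le_maxPeak (i : B) : M.lam i 0 ≤ M.maxPeak := 
  le_ciSup (f := fun i => M.lam i 0) (Finite.bddAbove_range _) i

variable (M) in
lemma minPeak_pos : 0 < M.minPeak := by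
  obtain ⟨i, hi⟩ := exists_eq_ciInf_of_finite (f := fun i => M.lam i 0)
  rw [minPeak, ← hi]
  exact M.lam_pos i 0 (M.zero_mem i)

variable (M) in
lemma one_le_peakRatio : 1 ≤ M.peakRatio := by
  obtain ⟨i⟩ := ‹Nonempty B›
  rw [peakRatio, one_le_div M.minPeak_pos]
  exact (minPeak_le i).trans (le_maxPeak i)

variable (M) in
lemma log_peakRatio_nonneg : 0 ≤ Real.log M.peakRatio := Real.log_nonneg M.one_le_peakRatio

lemma lam_zero_le (i : B) : M.lam i 0 ≤ Real.exp (Real.log M.peakRatio) * M.minPeak := by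
  rw [Real.exp_log (by linarith [M.one_le_peakRatio]), peakRatio,
    div_mul_cancel₀ _ M.minPeak_pos.ne']
  exact le_maxPeak i

end Peaks

end Market
end EnvyFreePricing

namespace EnvyFreePricing
namespace Market

variable {B S : Type*} [Fintype B] [Fintype S] {M : Market B S}

/-! ### The bicriteria algorithm -/

/-- The candidates of a run of the bicriteria algorithm. -/
structure IsCandidateSeq (M : Market B S) (cand : ℕ → Solution B S) : Prop where
  envyFree_zero : M.IsEnvyFree (cand 0)
  priced : M.IsCriterionPriced M.minPeak (cand 0)
  candidate : ∀ n, 1 ≤ n → n ≤ ⌈Real.log M.peakRatio⌉₊ → M.IsCandidate (cand 0) n (cand n)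

namespace IsCandidateSeq

variable {cand : ℕ → Solution B S}

lemma envyFree (h : M.IsCandidateSeq cand) {n : ℕ} (hn : n ≤ ⌈Real.log M.peakRatio⌉₊) :
    M.IsEnvyFree (cand n) := by
  rcases Nat.eq_zero_or_pos n with rfl | h1
  · exact h.envyFree_zero
  · exact (h.candidate n h1 hn).2.1

lemma payment_nonneg (h : M.IsCandidateSeq cand) (hD : M.IsDoublyConvex) {n : ℕ}
    (hn : n ≤ ⌈Real.log M.peakRatio⌉₊) :
    0 ≤ ∑ t, (cand n).price t * supply (cand n).alloc t := by
  refine Finset.sum_nonneg fun t _ => mul_nonneg ?_ (supply_nonneg (h.envyFree hn).1.1 t)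
  have h0 : 0 ≤ (cand 0).price t :=
    (hD.mcost_nonneg t (supply_nonneg h.envyFree_zero.1.1 t)).trans (h.priced.mcost_le t)
  rcases Nat.eq_zero_or_pos n with rfl | h1
  · exact h0
  · rw [(h.candidate n h1 hn).1]
    exact h0.trans (le_max_left _ _)

lemma payment_le (h : M.IsCandidateSeq cand) (hD : M.IsDoublyConvex) {n : ℕ}
    (hn : n ≤ ⌈Real.log M.peakRatio⌉₊) :
    ∑ t, (cand n).price t * supply (cand n).alloc t ≤ 2 * M.revenue (cand n) := by
  rcases Nat.eq_zero_or_pos n with rfl | h1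
  · exact h.priced.payment_le hD h.envyFree_zero
  · exact (h.candidate n h1 hn).payment_le hD h.envyFree_zero h.priced

variable [Nonempty B]

lemma minPeak_le_mul (h : M.IsCandidateSeq cand) (hD : M.IsDoublyConvex) (i : B) :
    M.minPeak ≤ Real.exp 1 * M.minPrice (cand 0).price i := by
  obtain ⟨t, -, hp⟩ := exists_minPrice (M := M) (cand 0).price i
  rw [hp]
  exact h.priced.le_price hD h.envyFree_zero.1.1 t

lemma minPrice_zero_nonneg (h : M.IsCandidateSeq cand) (hD : M.IsDoublyConvex) (i : B) :
    0 ≤ M.minPrice (cand 0).price i :=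
  (pos_of_mul_pos_right (M.minPeak_pos.trans_le (h.minPeak_le_mul hD i))
    (Real.exp_pos 1).le).le

lemma minPrice_succ_le (h : M.IsCandidateSeq cand) (hD : M.IsDoublyConvex) {n : ℕ}
    (hn : n + 1 ≤ ⌈Real.log M.peakRatio⌉₊) (i : B) :
    M.minPrice (cand (n + 1)).price i ≤ Real.exp 1 * M.minPrice (cand n).price i := by
  have he := exp_one_gt
  have h0 := h.minPrice_zero_nonneg hD i
  rw [(h.candidate (n + 1) (by omega) hn).minPrice_eq i]
  rcases Nat.eq_zero_or_pos n with rfl | h1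
  · refine max_le (by nlinarith) ?_
    simpa using h.minPeak_le_mul hD i
  · rw [(h.candidate n h1 (by omega)).minPrice_eq i]
    refine max_le ?_ ?_
    · nlinarith [le_max_left (M.minPrice (cand 0).price i)
        (Real.exp ((n : ℝ) - 1) * M.minPeak)]
    · have : Real.exp (((n + 1 : ℕ) : ℝ) - 1) = Real.exp 1 * Real.exp ((n : ℝ) - 1) := by
        rw [← Real.exp_add]; push_cast; ring_nf
      rw [this, mul_assoc]
      exact mul_le_mul_of_nonneg_left (le_max_right _ _) (Real.exp_pos 1).le

lemma lam_zero_le_mul (h : M.IsCandidateSeq cand) (hD : M.IsDoublyConvex) (i : B) :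
    M.lam i 0 ≤ Real.exp 1 * M.minPrice (cand ⌈Real.log M.peakRatio⌉₊).price i := by
  refine (lam_zero_le i).trans ?_
  set N := ⌈Real.log M.peakRatio⌉₊ with hN
  have hle : Real.log M.peakRatio ≤ N := Nat.le_ceil _
  rcases Nat.eq_zero_or_pos N with h0 | h1
  · rw [h0] at hle ⊢
    refine le_trans ?_ (h.minPeak_le_mul hD i)
    refine mul_le_of_le_one_left M.minPeak_pos.le ?_
    rw [Real.exp_le_one_iff]
    exact_mod_cast hle
  · rw [(h.candidate N h1 le_rfl).minPrice_eq i]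
    refine le_trans ?_ (mul_le_mul_of_nonneg_left (le_max_right _ _) (Real.exp_pos 1).le)
    rw [← mul_assoc, ← Real.exp_add]
    refine mul_le_mul_of_nonneg_right (Real.exp_le_exp.2 ?_) M.minPeak_pos.le
    linarith

/-- The gross surplus lost between the candidates `0` and `j + 1`, if the candidates up to `j`
have small payments. -/
lemma gross_sub_le (h : M.IsCandidateSeq cand) (hD : M.IsDoublyConvex) {a : ℝ} (j : ℕ)
    (hj : j + 1 ≤ ⌈Real.log M.peakRatio⌉₊)
    (ha : ∀ m ≤ j, ∑ t, (cand m).price t * supply (cand m).alloc t ≤ a) :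
    (∑ i, ∫ x in (0 : ℝ)..demand (cand 0).alloc i, M.lam i x) -
      ∑ i, ∫ x in (0 : ℝ)..demand (cand (j + 1)).alloc i, M.lam i x ≤
      Real.exp 1 * a + (Real.exp 1 - 1) * (j * a) -
        ∑ t, (cand (j + 1)).price t * supply (cand (j + 1)).alloc t := by
  have he := exp_one_gt
  -- The units dropped are worth at most the new price each, and the new price is at most `e` times
  -- the old one. In the sum, each intermediate payment keeps the coefficient `e - 1`.
  have hstep : ∀ m, m + 1 ≤ ⌈Real.log M.peakRatio⌉₊ →
      (∑ i, ∫ x in (0 : ℝ)..demand (cand m).alloc i, M.lam i x) -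
        ∑ i, ∫ x in (0 : ℝ)..demand (cand (m + 1)).alloc i, M.lam i x ≤
      Real.exp 1 * ∑ t, (cand m).price t * supply (cand m).alloc t -
        ∑ t, (cand (m + 1)).price t * supply (cand (m + 1)).alloc t := by
    intro m hm
    have hm0 := h.envyFree (n := m) (by omega)
    have hm1 := h.envyFree hm
    rw [hm0.payment_eq, hm1.payment_eq, Finset.mul_sum, ← Finset.sum_sub_distrib,
      ← Finset.sum_sub_distrib]
    refine Finset.sum_le_sum fun i _ => ?_
    have h1 := (hm1.2.1 i).integral_le (hm0.2.1 i).1 (hm0.2.1 i).2.1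
    have h2 := mul_le_mul_of_nonneg_right (h.minPrice_succ_le hD hm i) (hm0.2.1 i).1
    linarith
  induction j with
  | zero =>
    have h1 := hstep 0 hj
    have h2 := ha 0 le_rfl
    simp only [zero_add, Nat.cast_zero, zero_mul, mul_zero, add_zero] at h1 ⊢
    nlinarith
  | succ j ih =>
    have h1 := ih (by omega) fun m hm => ha m (by omega)
    have h2 := hstep (j + 1) hj
    have h3 := ha (j + 1) le_rfl
    push_cast
    nlinarith

/-- Some candidate has the required revenue. -/
lemma exists_revenue_ge (h : M.IsCandidateSeq cand) (hD : M.IsDoublyConvex) :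
    ∃ n ≤ ⌈Real.log M.peakRatio⌉₊,
      1 / 2 * (M.welfare (cand 0).alloc / (4.5 * (1 + Real.log M.peakRatio))) ≤
        M.revenue (cand n) := by
  have he := exp_one_gt
  have he' := exp_one_lt
  have hL := M.log_peakRatio_nonneg
  have hNlt := Nat.ceil_lt_add_one hL
  set L := Real.log M.peakRatio with hLdef
  set N := ⌈L⌉₊ with hN
  set ρ := 1 / 2 * (M.welfare (cand 0).alloc / (4.5 * (1 + L))) with hρ
  have hρW : M.welfare (cand 0).alloc = 9 * (1 + L) * ρ := by
    rw [hρ]; field_simp; norm_num; ring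
  by_contra! hlt
  have ha : ∀ m ≤ N, ∑ t, (cand m).price t * supply (cand m).alloc t ≤ 2 * ρ := fun m hm => by
    linarith [h.payment_le hD hm, hlt m hm]
  have hρ0 : 0 < ρ := by
    linarith [h.payment_le hD (Nat.zero_le N), hlt 0 (Nat.zero_le N),
      h.payment_nonneg hD (Nat.zero_le N)]
  -- At the last prices every value is at most `e` times what the buyer pays.
  have hlast : ∑ i, ∫ x in (0 : ℝ)..demand (cand N).alloc i, M.lam i x ≤
      Real.exp 1 * ∑ t, (cand N).price t * supply (cand N).alloc t := by
    have hEF := h.envyFree (n := N) le_rfl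
    rw [hEF.payment_eq, Finset.mul_sum]
    refine Finset.sum_le_sum fun i _ => ?_
    have hb := hEF.2.1 i
    have h1 := M.integral_lam_le i le_rfl hb.1 hb.2.1 fun z hz =>
      M.lam_le_zero i ⟨hz.1.le, hz.2.trans_le hb.2.1⟩
    have h2 := mul_le_mul_of_nonneg_right (h.lam_zero_le_mul hD i) hb.1
    linarith
  have hG : M.welfare (cand 0).alloc ≤
      ∑ i, ∫ x in (0 : ℝ)..demand (cand 0).alloc i, M.lam i x := by
    have := totalCost_nonneg hD h.envyFree_zero.1.1
    rw [welfare]; linarith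
  have hN1 := ha N le_rfl
  have hkey : M.welfare (cand 0).alloc ≤
      Real.exp 1 * (2 * ρ) + (Real.exp 1 - 1) * (N * (2 * ρ)) := by
    rcases Nat.eq_zero_or_pos N with h0 | h1
    · rw [h0] at hlast hN1 ⊢
      simp only [Nat.cast_zero, zero_mul, mul_zero, add_zero]
      nlinarith
    · obtain ⟨j, hj⟩ : ∃ j, N = j + 1 := ⟨N - 1, by omega⟩
      have h2 := h.gross_sub_le hD j hj.ge fun m hm => ha m (by omega)
      rw [hj] at hlast hN1 ⊢
      push_cast
      nlinarith
  have h1 : (Real.exp 1 - 1) * (N * (2 * ρ)) ≤ (Real.exp 1 - 1) * ((L + 1) * (2 * ρ)) := by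
    gcongr
    linarith
  -- The bracket is least at `L = 0`, where it equals `11 - 4 * e > 0`; this is where the constant
  -- `4.5 > 2 * e - 1` is needed.
  have h2 : 0 < ρ * (9 * (1 + L) - 2 * Real.exp 1 - 2 * (Real.exp 1 - 1) * (L + 1)) :=
    mul_pos hρ0 (by nlinarith)
  linarith

/-- The first candidate with the required revenue keeps most of the welfare. -/
lemma welfare_ge (h : M.IsCandidateSeq cand) (hD : M.IsDoublyConvex) {j : ℕ}
    (hj : j ≤ ⌈Real.log M.peakRatio⌉₊)
    (hlt : ∀ m < j, M.revenue (cand m) <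
      1 / 2 * (M.welfare (cand 0).alloc / (4.5 * (1 + Real.log M.peakRatio))))
    (hW : 0 ≤ M.welfare (cand 0).alloc) :
    (1 - 2 * Real.exp 1 / 9) * M.welfare (cand 0).alloc ≤ M.welfare (cand j).alloc := by
  have he := exp_one_gt
  have he' := exp_one_lt
  rcases Nat.eq_zero_or_pos j with rfl | h1
  · nlinarith
  obtain ⟨j, rfl⟩ : ∃ i, j = i + 1 := ⟨j - 1, by omega⟩
  have hL := M.log_peakRatio_nonneg
  have hNlt := Nat.ceil_lt_add_one hL
  set L := Real.log M.peakRatio with hLdef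
  set ρ := 1 / 2 * (M.welfare (cand 0).alloc / (4.5 * (1 + L))) with hρ
  have hρW : M.welfare (cand 0).alloc = 9 * (1 + L) * ρ := by
    rw [hρ]; field_simp; norm_num; ring
  have hρ0 : 0 ≤ ρ := by positivity
  have hjL : (j : ℝ) ≤ L := by
    have : ((j + 1 : ℕ) : ℝ) ≤ ⌈L⌉₊ := Nat.cast_le.2 hj
    push_cast at this
    linarith
  have h2 := h.gross_sub_le hD (a := 2 * ρ) j hj fun m hm => by
    linarith [h.payment_le hD (show m ≤ ⌈L⌉₊ by omega), hlt m (by omega)]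
  have h3 := h.payment_nonneg hD hj
  have h4 := (h.candidate (j + 1) (by omega) hj).totalCost_le hD h.envyFree_zero
  -- Weakening `e - 1` to `e` makes the total loss `2 * e * (1 + L) * ρ`, which is `2 * e / 9` of
  -- the initial welfare.
  have h5 : (Real.exp 1 - 1) * (j * (2 * ρ)) ≤ Real.exp 1 * (L * (2 * ρ)) := by
    gcongr
    linarith
  have h6 : M.welfare (cand 0).alloc - M.welfare (cand (j + 1)).alloc ≤
      Real.exp 1 * (2 * ρ) + Real.exp 1 * (L * (2 * ρ)) := by
    rw [welfare, welfare]; linarith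
  nlinarith

end IsCandidateSeq

variable [Nonempty B]

lemma nonempty_item (M : Market B S) : Nonempty S := by
  obtain ⟨i⟩ := ‹Nonempty B›
  exact (M.items_nonempty i).to_type

lemma one_lt_exp_one : (1 : ℝ) < Real.exp 1 := Real.one_lt_exp_iff.2 one_pos

lemma isCandidateSeq_of_ascReturns (hM : M.IsMHR) {cand : ℕ → Solution B S}
    (h0 : M.AscReturns (Real.exp 1) M.minPeak (cand 0))
    (h : ∀ n, 1 ≤ n → n ≤ ⌈Real.log M.peakRatio⌉₊ → M.IsCandidate (cand 0) n (cand n)) :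
    M.IsCandidateSeq cand := by
  have := M.nonempty_item
  obtain ⟨h1, h2⟩ := h0.spec hM minPeak_le one_lt_exp_one
  exact ⟨h1, h2, h⟩

lemma exists_bicriteriaReturns (hM : M.IsMHR) (hD : M.IsDoublyConvex) :
    ∃ s, M.BicriteriaReturns s := by
  have := M.nonempty_item
  obtain ⟨s₀, hs₀⟩ := exists_ascReturns hM (minPeak_le (M := M)) one_lt_exp_one
  choose c hc using exists_isCandidate (hs₀.spec hM minPeak_le one_lt_exp_one).1
  set cand : ℕ → Solution B S := fun n => if n = 0 then s₀ else c n with hcand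
  have h0 : M.AscReturns (Real.exp 1) M.minPeak (cand 0) := by simpa [hcand] using hs₀
  have h1 : ∀ n, 1 ≤ n → n ≤ ⌈Real.log M.peakRatio⌉₊ → M.IsCandidate (cand 0) n (cand n) :=
    fun n hn _ => by simpa [hcand, show n ≠ 0 by omega] using hc n
  obtain ⟨n, hn⟩ := (isCandidateSeq_of_ascReturns hM h0 h1).exists_revenue_ge hD
  exact ⟨_, cand, _, h0, h1, ⟨Nat.sInf_mem ⟨n, hn⟩, fun m hm => Nat.sInf_le hm⟩, rfl⟩

/-- A returned solution is envy-free, its revenue is within a logarithmic factor of the welfare of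
the ascending-price solution, and its welfare is a constant fraction of the optimum. -/
lemma BicriteriaReturns.spec (hM : M.IsMHR) (hD : M.IsDoublyConvex) {s : Solution B S}
    (h : M.BicriteriaReturns s) :
    M.IsEnvyFree s ∧ (∀ z, M.IsFeasible z → (Real.exp 1 - 1) * M.welfare z ≤
        Real.exp 1 * (9 * (1 + Real.log M.peakRatio) * M.revenue s)) ∧
      ∀ z, M.IsFeasible z → 1 / 4 * M.welfare z ≤ M.welfare s.alloc := by
  obtain ⟨cand, j, h0, hc, ⟨⟨hj, hrev⟩, hleast⟩, rfl⟩ := h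
  have hseq := isCandidateSeq_of_ascReturns hM h0 hc
  have he := exp_one_gt
  have he' := exp_one_lt
  have hL := M.log_peakRatio_nonneg
  have hopt := fun z hz => hseq.priced.welfare_ge hM hD hseq.envyFree_zero minPeak_le (z := z) hz
  have hW : 0 ≤ M.welfare (cand 0).alloc := by
    have := hopt _ M.isFeasible_zero
    have h1 : M.welfare (fun _ _ => 0) = 0 := by
      simp [welfare, demand, totalCost, supply, M.cost_zero]
    rw [h1, mul_zero] at this
    exact nonneg_of_mul_nonneg_right this (Real.exp_pos 1)
  refine ⟨hseq.envyFree hj, fun z hz => (hopt z hz).trans ?_, fun z hz => ?_⟩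
  · refine mul_le_mul_of_nonneg_left ?_ (Real.exp_pos 1).le
    have h1 : M.welfare (cand 0).alloc = 9 * (1 + Real.log M.peakRatio) *
        (1 / 2 * (M.welfare (cand 0).alloc / (4.5 * (1 + Real.log M.peakRatio)))) := by
      field_simp; norm_num; ring
    rw [h1]
    exact mul_le_mul_of_nonneg_left hrev (by positivity)
  · have h1 := hseq.welfare_ge hD hj (fun m hm => by
      by_contra! hge
      exact (hleast ⟨hm.le.trans hj, hge⟩).not_gt hm) hW
    have h2 := hopt z hz
    -- This is `(1 - 2 * e / 9) * (1 - 1 / e) ≥ 1 / 4` without denominators; the left side is about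
    -- `0.2503`.
    have h3 : 9 * Real.exp 1 / 4 ≤ (9 - 2 * Real.exp 1) * (Real.exp 1 - 1) := by nlinarith
    have h4 := mul_le_mul_of_nonneg_right h3 hW
    have h5 : M.welfare z * (Real.exp 1 - 1) ≤
        4 * M.welfare (cand j).alloc * (Real.exp 1 - 1) := by nlinarith
    have := le_of_mul_le_mul_right h5 (by linarith)
    linarith

end Market
end EnvyFreePricing

end

theorem mainTheorem4 :
    ∃ K : ℝ, 0 < K ∧
      ∀ (B S : Type*) [Fintype B] [Fintype S] [Nonempty B]
        (M : EnvyFreePricing.Market B S), M.IsMHR → M.IsDoublyConvex →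
        (∃ s, M.BicriteriaReturns s) ∧
        ∀ s, M.BicriteriaReturns s →
          M.IsEnvyFree s ∧
          (∀ s', M.IsEnvyFree s' →
            M.revenue s' ≤ K * (1 + Real.log M.peakRatio) * M.revenue s) ∧
          (∀ y, M.IsFeasible y → 1 / 4 * M.welfare y ≤ M.welfare s.alloc) := by
  have he := EnvyFreePricing.Market.one_lt_exp_one
  -- The factor `9` comes from the revenue threshold and `e / (e - 1)` from the welfare loss of the
  -- ascending-price solution.
  refine ⟨9 * Real.exp 1 / (Real.exp 1 - 1), div_pos (by positivity) (by linarith), ?_⟩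
  intro B S _ _ _ M hM hD
  refine ⟨EnvyFreePricing.Market.exists_bicriteriaReturns hM hD, fun s hs => ?_⟩
  obtain ⟨h1, h2, h3⟩ := hs.spec hM hD
  refine ⟨h1, fun s' hs' => ?_, h3⟩
  have h4 := h2 _ hs'.1
  have h5 := hs'.revenue_le_welfare
  rw [div_mul_eq_mul_div, div_mul_eq_mul_div, le_div_iff₀ (by linarith)]
  nlinarith
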